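/- Let $(\mathcal A,\varphi,\varphi')$ be an infinitesimal probability space: $\mathcal A$ is a unital complex algebra and $\varphi,\varphi':\mathcal A\to\mathbb C$ are linear with $\varphi(1)=1$, $\varphi'(1)=0$. *Transforms.* For $a\in\mathcal A$ with $\varphi(a)\neq 0$ consider the formal power series $\psi_a(z)=\sum_{n\ge 1}\varphi(a^n)z^n$ and $\partial\psi_a(z)=\sum_{n\ge1}\varphi'(a^n)z^n$, and let $\chi_a=\psi_a^{\langle -1\rangle}$ be the compositional inverse of $\psi_a$. Put $$S_a(z)=\frac{1+z}{z}\,\chi_a(z),\qquad \partial S_a(z)=-\frac{1+z}{z}\,\chi_a'(z)\,\partial\psi_a(\chi_a(z)),$$ $$T_a(z)=\frac1{S_a(z)},\qquad \partial T_a(z)=-T_a(z)\,\partial S_a(z)\,T_a(z).$$ *Infinitesimal freeness.* Elements $x,y$ are infinitesimally free if, with $\mathcal A_1,\mathcal A_2$ the unital subalgebras generated by $x$ and by $y$, for all $n\ge1$, all indices $i_1\neq i_2\neq\cdots\neq i_n$ (consecutive ones distinct) and all $a_j\in\mathcal A_{i_j}$ with $\varphi(a_j)=0$ one has $\varphi(a_1\cdots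 a_n)=0$ and $\varphi'(a_1\cdots a_n)=\sum_{j=1}^n\varphi'(a_j)\,\varphi(a_1\cdots a_{j-1}a_{j+1}\cdots a_n)$. We say that $y$ is an infinitesimally free copy of $x$ if moreover $\varphi(y^k)=\varphi(x^k)$ and $\varphi'(y^k)=\varphi'(x^k)$ for all $k$. *Wishart limit.* Let $X_N=\frac1N G^*G$, where $G$ is an $M\times N$ matrix with independent standard complex Gaussian entries (mean $0$, $\mathbb E|g|^2=1$, real and imaginary parts independent $N(0,\tfrac12)$), and let $\mathrm{tr}=\frac1N\mathrm{Tr}$. For real $c,c'$, an element $x\in\mathcal A$ is a Wishart limit with parameters $c,c'$ if, along some sequence of sizes $(M,N)$ with $N\to\infty$, $M/N\to c$ and $M-Nc\to c'$, for every $k\ge0$ $$\varphi(x^k)=\lim \mathbb E\big(\mathrm{tr}(X_N^k)\big),\qquad \varphi'(x^k)=\lim N\big[\mathbb E\big(\mathrm{tr}(X_N^k)\big)-\varphi(x^k)\big].$$ **Theorem.** Let $c\neq0$, let $x\in\mathcal A$ be a Wishart limit with parameters $c,c'$, and let $y\in\mathcal A$ be an infinitesimally free copy of $x$. Then $\varphi(xy)\ne0$,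 so that the transforms of $xy$ are defined, and $$T_{xy}(z)=c^2+2cz+z^2\qquad\text{and}\qquad \partial T_{xy}(z)=2c'(c+z).$$ -/

import Mathlib

open MeasureTheory ProbabilityTheory Filter Topology PowerSeries

/-- A (scalar-valued) infinitesimal probability space `(A, φ, φ')`: a unital complex algebra with
linear functionals `phi`, `dphi` such that `phi 1 = 1` and `dphi 1 = 0`. -/
structure InfProbSpace (A : Type*) [Ring A] [Algebra ℂ A] where
  phi : A →ₗ[ℂ] ℂ
  dphi : A →ₗ[ℂ] ℂ
  phi_one : phi 1 = 1
  dphi_one : dphi 1 = 0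

namespace InfProbSpace

variable {A : Type*} [Ring A] [Algebra ℂ A] (P : InfProbSpace A)

/-- Infinitesimal freeness of a family of unital subalgebras: for every nonempty alternating word
`a₀ a₁ ⋯ aₙ` of centred elements, `φ(a₀ ⋯ aₙ) = 0` and
`φ'(a₀ ⋯ aₙ) = ∑ⱼ φ'(aⱼ) φ(a₀ ⋯ aⱼ₋₁ aⱼ₊₁ ⋯ aₙ)`. -/
def InfFree {ι : Type*} (S : ι → Subalgebra ℂ A) : Prop :=
  ∀ (n : ℕ) (i : Fin (n + 1) → ι) (a : Fin (n + 1) → A),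
    (∀ j : Fin n, i j.castSucc ≠ i j.succ) →
    (∀ j, a j ∈ S (i j)) → (∀ j, P.phi (a j) = 0) →
      P.phi (List.ofFn a).prod = 0 ∧
      P.dphi (List.ofFn a).prod =
        ∑ j, P.dphi (a j) * P.phi (List.ofFn fun k : Fin n => a (j.succAbove k)).prod

/-- Two elements are infinitesimally free if the unital algebras they generate are. -/
def InfFreePair (x y : A) : Prop :=
  P.InfFree fun i : Fin 2 => Algebra.adjoin ℂ {![x, y] i}

/-- `x` and `y` have the same infinitesimal distribution. -/
def SameInfDistribution (x y : A) : Prop :=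
  ∀ k : ℕ, P.phi (x ^ k) = P.phi (y ^ k) ∧ P.dphi (x ^ k) = P.dphi (y ^ k)

/-- `y` is an infinitesimally free copy of `x`. -/
def IsInfFreeCopy (x y : A) : Prop :=
  P.SameInfDistribution x y ∧ P.InfFreePair x y

/-- The moment series `ψ_a(z) = ∑_{n ≥ 1} φ(aⁿ) zⁿ`. -/
noncomputable def psi (a : A) : ℂ⟦X⟧ :=
  PowerSeries.mk fun n => if n = 0 then 0 else P.phi (a ^ n)

/-- The infinitesimal moment series `∂ψ_a(z) = ∑_{n ≥ 1} φ'(aⁿ) zⁿ`. -/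
noncomputable def dpsi (a : A) : ℂ⟦X⟧ :=
  PowerSeries.mk fun n => if n = 0 then 0 else P.dphi (a ^ n)

theorem isUnit_coeff_one_psi {a : A} (ha : P.phi a ≠ 0) : IsUnit (coeff 1 (P.psi a)) := by
  simpa [psi] using ha

/-- The compositional inverse `ψ_a^{⟨-1⟩}`, defined when `φ(a) ≠ 0`. -/
noncomputable def psiInv (a : A) (ha : P.phi a ≠ 0) : ℂ⟦X⟧ :=
  (P.psi a).substInvOfIsUnit (P.isUnit_coeff_one_psi ha)

/-- `psiInv` is a two-sided compositional inverse of `psi`. -/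
theorem psi_subst_psiInv (a : A) (ha : P.phi a ≠ 0) :
    (P.psi a).subst (P.psiInv a ha) = (X : ℂ⟦X⟧) ∧
      (P.psiInv a ha).subst (P.psi a) = (X : ℂ⟦X⟧) :=
  ⟨subst_substInvOfIsUnit_right _ (by simp [psi]) _,
    subst_substInvOfIsUnit_left _ (by simp [psi]) _⟩

/-- The infinitesimal part of the compositional inverse,
`∂(ψ_a^{⟨-1⟩}) = - (ψ_a^{⟨-1⟩})' · (∂ψ_a ∘ ψ_a^{⟨-1⟩})`, that is,
`ψ_a^{⟨-1⟩} + ε ∂(ψ_a^{⟨-1⟩})` is the compositional inverse of `ψ_a + ε ∂ψ_a` over the dual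
numbers `ε² = 0`. -/
noncomputable def dpsiInv (a : A) (ha : P.phi a ≠ 0) : ℂ⟦X⟧ :=
  -(derivative ℂ (P.psiInv a ha) * (P.dpsi a).subst (P.psiInv a ha))

/-- `f ↦ f / z` for a power series without constant term. -/
noncomputable def divZ (f : ℂ⟦X⟧) : ℂ⟦X⟧ :=
  PowerSeries.mk fun n => coeff (n + 1) f

theorem X_mul_divZ (f : ℂ⟦X⟧) (hf : constantCoeff f = 0) : X * divZ f = f := by
  ext n
  cases n with
  | zero => simp [hf]
  | succ n => simp [divZ, coeff_succ_X_mul]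

/-- The `S`-transform `S_a(z) = z⁻¹ (1 + z) ψ_a^{⟨-1⟩}(z)`. -/
noncomputable def STransform (a : A) (ha : P.phi a ≠ 0) : ℂ⟦X⟧ :=
  (1 + X) * divZ (P.psiInv a ha)

/-- The infinitesimal `S`-transform `∂S_a(z) = z⁻¹ (1 + z) ∂(ψ_a^{⟨-1⟩})(z)`. -/
noncomputable def dSTransform (a : A) (ha : P.phi a ≠ 0) : ℂ⟦X⟧ :=
  (1 + X) * divZ (P.dpsiInv a ha)

/-- The constant terms of `ψ_a^{⟨-1⟩}` and `∂(ψ_a^{⟨-1⟩})` vanish, so that both divisions by `z`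
are exact, and that of `S_a` is nonzero, so that `1 / S_a` exists. -/
theorem transforms_wellDefined (a : A) (ha : P.phi a ≠ 0) :
    constantCoeff (P.psiInv a ha) = 0 ∧ constantCoeff (P.dpsiInv a ha) = 0 ∧
      constantCoeff (P.STransform a ha) ≠ 0 := by
  have h0 : constantCoeff (P.psiInv a ha) = 0 := by simp [psiInv]
  refine ⟨h0, ?_, ?_⟩
  · have h1 : constantCoeff ((P.dpsi a).subst (P.psiInv a ha)) = 0 :=
      constantCoeff_subst_eq_zero h0 _ (by simp [dpsi])
    simp only [dpsiInv, map_neg, map_mul, h1, mul_zero, neg_zero]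
  · have h1 : coeff 1 (P.psiInv a ha) ≠ 0 := by
      rw [psiInv, coeff_one_substInvOfIsUnit]
      exact Units.ne_zero _
    simpa [STransform, divZ] using h1

/-- The `T`-transform `T_a = 1 / S_a`. -/
noncomputable def TTransform (a : A) (ha : P.phi a ≠ 0) : ℂ⟦X⟧ :=
  (P.STransform a ha)⁻¹

/-- The infinitesimal `T`-transform `∂T_a = - T_a · ∂S_a · T_a`. -/
noncomputable def dTTransform (a : A) (ha : P.phi a ≠ 0) : ℂ⟦X⟧ :=
  -(P.TTransform a ha * P.dSTransform a ha * P.TTransform a ha)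

end InfProbSpace

/-- The standard complex Gaussian law: independent real and imaginary parts, each `N(0, 1/2)`. -/
noncomputable def stdComplexGaussian : Measure ℂ :=
  ((gaussianReal 0 (1 / 2)).prod (gaussianReal 0 (1 / 2))).map Complex.measurableEquivRealProd.symm

/-- The law of an `M × N` matrix with independent standard complex Gaussian entries. -/
noncomputable def complexGaussianMatrix (M N : ℕ) : Measure (Fin M → Fin N → ℂ) :=
  Measure.pi fun _ => Measure.pi fun _ => stdComplexGaussian

/-- The `N × N` complex Wishart matrix `X_N = N⁻¹ G* G` built from the `M × N` matrix `G`. -/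
noncomputable def wishartMatrix {M N : ℕ} (G : Fin M → Fin N → ℂ) : Matrix (Fin N) (Fin N) ℂ :=
  (N : ℂ)⁻¹ • ((Matrix.of G).conjTranspose * Matrix.of G)

/-- `E[tr(X_Nᵏ)]`, where `tr = N⁻¹ Tr` is the normalized trace. -/
noncomputable def wishartMoment (M N k : ℕ) : ℂ :=
  ∫ G, (N : ℂ)⁻¹ * (wishartMatrix G ^ k).trace ∂(complexGaussianMatrix M N)

/-- `x` is an infinitesimal limit of complex Wishart matrices with parameters `c`, `c'`: along some
sizes `(M, N)` with `N → ∞`, `M / N → c` and `M - N c → c'`, one has `E[tr(X_Nᵏ)] → φ(xᵏ)` and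
`N (E[tr(X_Nᵏ)] - φ(xᵏ)) → φ'(xᵏ)` for every `k`. -/
def InfProbSpace.IsWishartLimit {A : Type*} [Ring A] [Algebra ℂ A] (P : InfProbSpace A)
    (x : A) (c c' : ℝ) : Prop :=
  ∃ M N : ℕ → ℕ, Tendsto N atTop atTop ∧
    Tendsto (fun n => (M n : ℝ) / (N n : ℝ)) atTop (𝓝 c) ∧
    Tendsto (fun n => (M n : ℝ) - (N n : ℝ) * c) atTop (𝓝 c') ∧
    ∀ k : ℕ,
      Tendsto (fun n => wishartMoment (M n) (N n) k) atTop (𝓝 (P.phi (x ^ k))) ∧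
      Tendsto (fun n => (N n : ℂ) * (wishartMoment (M n) (N n) k - P.phi (x ^ k))) atTop
        (𝓝 (P.dphi (x ^ k)))

/-! Over the dual numbers (`ε² = 0`), put `Φ = φ + εφ'` and `γ = c + εc'`. Both claims then come
from a single free-probability computation for `Φ` with parameter `γ`.

Matrix side. Gaussian integration by parts yields a loop equation for mixed trace moments of Wishart
matrices (`gaussianExpectation_genericTrace_succ_mul`). After normalization the term that merges two
traces carries a factor `N⁻²`, so mixed moments factorize up to `o(1/N)`
(`tendsto_mul_wishartCorrelator_sub_prod`). Since `M/N = c + c'/N + o(1/N)`, the orders `1` and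
`1/N` of the loop equation are the two components of `Φ(xᵏ⁺¹) = γ Φ(xᵏ) + ∑_{l<k} Φ(xˡ⁺¹) Φ(xᵏ⁻¹⁻ˡ)`
(`InfProbSpace.IsWishartLimit.moment_succ`).

Free side. Infinitesimal freeness gives ordinary freeness for `Φ`
(`InfProbSpace.InfFreePair.dualLaw_eq_zero`). The recursion says that `Φ(xp) = γ Φ(p) + (Φ ⊗ Φ)(d
p)` for powers `p` of `x`, with `d` a derivation into the tensor square, and freeness extends this
identity to all noncommutative polynomials in `x` and `y` (`map_mul_eq_add_tensorSquare`).
Everything is pulled back to the free algebra, where derivations with prescribed values on the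
generators exist. Applied to the words `(xy)ᵏ` and `y(xy)ᵏ`, the identities for `x` and for `y` form
a closed system, which in generating series reads `F = z(1 + F)(γ + F)²` with `F = ψ + ε∂ψ` for `xy`
(`series_eq_of_moments`).

Inversion gives `z = χ(1 + z)(γ + z)²`, hence formally `T = (γ + z)² = (c + z)² + ε·2c'(c + z)`. The
components are separated before inverting, and the algebra is done in
`InfProbSpace.transforms_of_psi_dpsi_eq`. -/

/-! ### Integration by parts for real and complex Gaussian variables -/

section GaussianIntegrationByParts

open Polynomial in
theorem integrable_polynomial_gaussianReal (v : NNReal) (p : ℂ[X]) :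
    Integrable (fun x : ℝ => p.eval (x : ℂ)) (gaussianReal 0 v) := by
  have hpow (n : ℕ) : Integrable (fun x : ℝ => (x : ℂ) ^ n) (gaussianReal 0 v) := by
    have h := (memLp_id_gaussianReal' (μ := 0) (v := v) n (by simp)).integrable_norm_pow'
    refine h.mono (by fun_prop) (ae_of_all _ fun x => ?_)
    simp
  simp_rw [eval_eq_sum_range]
  exact integrable_finsetSum _ fun n _ => (hpow n).const_mul _

open Polynomial in
/-- Gaussian integration by parts on the line, for polynomials. -/
theorem integral_mul_polynomial_gaussianReal {v : NNReal} (hv : v ≠ 0) (p : ℂ[X]) :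
    ∫ x : ℝ, (x : ℂ) * p.eval (x : ℂ) ∂(gaussianReal 0 v) =
      (v : ℂ) * ∫ x : ℝ, (derivative p).eval (x : ℂ) ∂(gaussianReal 0 v) := by
  have hint (q : ℂ[X]) : Integrable fun x : ℝ => q.eval (x : ℂ) * (gaussianPDFReal 0 v x : ℂ) := by
    have h := integrable_polynomial_gaussianReal v q
    rw [gaussianReal_of_var_ne_zero _ hv, integrable_withDensity_iff_integrable_smul'
      (measurable_gaussianPDF _ _) (ae_of_all _ fun _ => gaussianPDF_lt_top)] at h
    refine h.congr (ae_of_all _ fun x => ?_)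
    simp [toReal_gaussianPDF, mul_comm]
  have hv' : (v : ℝ) ≠ 0 := by simpa using hv
  have hpdf (x : ℝ) : HasDerivAt (fun x : ℝ => (gaussianPDFReal 0 v x : ℂ))
      (-(x : ℂ) / (v : ℂ) * (gaussianPDFReal 0 v x : ℂ)) x := by
    have h : HasDerivAt (gaussianPDFReal 0 v) (-x / v * gaussianPDFReal 0 v x) x := by
      have h1 : HasDerivAt (fun x : ℝ => -(x - 0) ^ 2 / (2 * (v : ℝ))) (-x / v) x := by
        have := (((hasDerivAt_id x).sub_const 0).pow 2).neg.div_const (2 * (v : ℝ))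
        refine this.congr_deriv ?_
        simp
        field_simp
      have h2 := (h1.exp).const_mul (√(2 * Real.pi * v))⁻¹
      refine h2.congr_deriv ?_
      simp only [gaussianPDFReal]
      ring
    have := h.ofReal_comp
    refine this.congr_deriv ?_
    push_cast
    ring
  have hp (x : ℝ) : HasDerivAt (fun x : ℝ => p.eval (x : ℂ)) ((derivative p).eval (x : ℂ)) x :=
    (p.hasDerivAt (x : ℂ)).comp_ofReal
  have hibp := integral_mul_deriv_eq_deriv_mul_of_integrable
    (u := fun x : ℝ => p.eval (x : ℂ)) (u' := fun x : ℝ => (derivative p).eval (x : ℂ))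
    (v := fun x : ℝ => (gaussianPDFReal 0 v x : ℂ))
    (v' := fun x : ℝ => -(x : ℂ) / (v : ℂ) * (gaussianPDFReal 0 v x : ℂ))
    (fun x _ => hp x) (fun x _ => hpdf x)
    (by
      refine ((hint (Polynomial.X * p)).const_mul (-(v : ℂ)⁻¹)).congr (ae_of_all _ fun x => ?_)
      simp only [eval_mul, eval_X, Pi.mul_apply]
      ring)
    (hint _) (hint _)
  simp only [integral_gaussianReal_eq_integral_smul hv]
  have hvc : (v : ℂ) ≠ 0 := by exact_mod_cast hv'
  have h3 : ∫ x : ℝ, (gaussianPDFReal 0 v x) • ((x : ℂ) * p.eval (x : ℂ)) =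
      ∫ x : ℝ, (-(v : ℂ)) * (p.eval (x : ℂ) * (-(x : ℂ) / (v : ℂ) * (gaussianPDFReal 0 v x : ℂ))) := by
    congr 1 with x
    rw [Complex.real_smul]
    field_simp
  rw [h3, integral_const_mul, hibp, neg_mul_neg]
  congr 1
  congr 1 with x
  rw [Complex.real_smul, mul_comm]

theorem integral_stdComplexGaussian (f : ℂ → ℂ) :
    ∫ z, f z ∂stdComplexGaussian =
      ∫ p : ℝ × ℝ, f (p.1 + p.2 * Complex.I)
        ∂((gaussianReal 0 (1 / 2)).prod (gaussianReal 0 (1 / 2))) := by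
  rw [stdComplexGaussian, integral_map_equiv]
  congr 1 with p
  congr 1
  exact Complex.mk_eq_add_mul_I _ _

instance : IsProbabilityMeasure stdComplexGaussian :=
  Measure.isProbabilityMeasure_map Complex.measurableEquivRealProd.symm.measurable.aemeasurable

theorem integrable_stdComplexGaussian_iff (f : ℂ → ℂ) :
    Integrable f stdComplexGaussian ↔ Integrable (fun p : ℝ × ℝ => f (p.1 + p.2 * Complex.I))
        ((gaussianReal 0 (1 / 2)).prod (gaussianReal 0 (1 / 2))) := by
  rw [stdComplexGaussian, integrable_map_equiv]
  congr! 1 with p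
  ext p
  exact congrArg f (Complex.mk_eq_add_mul_I _ _)

theorem integrable_monomial_stdComplexGaussian (a b : ℕ) :
    Integrable (fun z : ℂ => z ^ a * (starRingEnd ℂ z) ^ b) stdComplexGaussian := by
  have hid (q : ℕ) : Integrable (fun z : ℂ => ‖z‖ ^ q) stdComplexGaussian := by
    have h : MemLp (fun z : ℂ => z) q stdComplexGaussian := by
      rw [stdComplexGaussian, memLp_map_measure_iff (by fun_prop) (by fun_prop)]
      have h0 : MemLp (fun x : ℝ => (x : ℂ)) q (gaussianReal 0 (1 / 2)) :=
        (memLp_id_gaussianReal' (μ := 0) (v := 1 / 2) q (by simp)).ofReal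
      refine ((h0.comp_fst (gaussianReal 0 (1 / 2))).add
        ((h0.comp_snd (gaussianReal 0 (1 / 2))).mul_const Complex.I)).ae_eq (ae_of_all _ fun p => ?_)
      exact (Complex.mk_eq_add_mul_I _ _).symm
    exact h.integrable_norm_pow'
  refine (hid (a + b)).mono (by fun_prop) (ae_of_all _ fun z => ?_)
  simp [pow_add]

/-- Gaussian integration by parts for the mixed moments of a standard complex Gaussian. -/
theorem integral_conj_mul_monomial_stdComplexGaussian (a b : ℕ) :
    ∫ z : ℂ, z ^ a * (starRingEnd ℂ z) ^ (b + 1) ∂stdComplexGaussian =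
      a * ∫ z : ℂ, z ^ (a - 1) * (starRingEnd ℂ z) ^ b ∂stdComplexGaussian := by
  set γ : Measure ℝ := gaussianReal 0 (1 / 2) with hγ
  have hconj (p : ℝ × ℝ) : starRingEnd ℂ ((p.1 : ℂ) + p.2 * Complex.I) =
      p.1 - p.2 * Complex.I := by simp [sub_eq_add_neg]
  have hI (a b : ℕ) : Integrable (fun p : ℝ × ℝ =>
      ((p.1 : ℂ) + p.2 * Complex.I) ^ a * ((p.1 : ℂ) - p.2 * Complex.I) ^ b) (γ.prod γ) := by
    have := (integrable_stdComplexGaussian_iff _).1 (integrable_monomial_stdComplexGaussian a b)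
    simpa only [hconj] using this
  have hv : ((1 / 2 : NNReal) : ℂ) = 1 / 2 := by
    simp [NNReal.coe_ofNat]
  set z : ℝ × ℝ → ℂ := fun p => (p.1 : ℂ) + p.2 * Complex.I with hz
  set w : ℝ × ℝ → ℂ := fun p => (p.1 : ℂ) - p.2 * Complex.I with hw
  -- The real coordinates are `(z + w)/2` and `(z - w)/(2i)`, so integrability reduces to that of
  -- the monomials in `z` and `w`.
  have hx1 : Integrable (fun p => (p.1 : ℂ) * (z p ^ a * w p ^ b)) (γ.prod γ) := by
    refine (((hI (a + 1) b).add (hI a (b + 1))).const_mul (1 / 2)).congr (ae_of_all _ fun p => ?_)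
    simp only [Pi.add_apply, hz, hw]
    ring
  have hy1 : Integrable (fun p => (p.2 : ℂ) * (z p ^ a * w p ^ b)) (γ.prod γ) := by
    refine (((hI (a + 1) b).sub (hI a (b + 1))).const_mul (-Complex.I / 2)).congr
      (ae_of_all _ fun p => ?_)
    simp only [Pi.sub_apply, hz, hw]
    ring_nf
    simp only [Complex.I_sq]
    ring
  have h1 : Integrable (fun p => z p ^ (a - 1) * w p ^ b) (γ.prod γ) := hI _ _
  have h2 : Integrable (fun p => z p ^ a * w p ^ (b - 1)) (γ.prod γ) := hI _ _
  have hx : ∫ p, (p.1 : ℂ) * (z p ^ a * w p ^ b) ∂(γ.prod γ) =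
      1 / 2 * ∫ p, a * (z p ^ (a - 1) * w p ^ b) + b * (z p ^ a * w p ^ (b - 1)) ∂(γ.prod γ) := by
    rw [integral_prod_symm _ hx1, integral_prod_symm
      (fun p => (a : ℂ) * (z p ^ (a - 1) * w p ^ b) + b * (z p ^ a * w p ^ (b - 1)))
      ((h1.const_mul _).add (h2.const_mul _)),
      ← integral_const_mul]
    congr 1 with y
    have := integral_mul_polynomial_gaussianReal (v := 1 / 2) (by simp)
      ((Polynomial.X + Polynomial.C (y * Complex.I)) ^ a *
        (Polynomial.X - Polynomial.C (y * Complex.I)) ^ b)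
    simp only [Polynomial.eval_mul, Polynomial.eval_pow, Polynomial.eval_add, Polynomial.eval_sub,
      Polynomial.eval_X, Polynomial.eval_C, hv] at this
    rw [this]
    congr 2 with x
    simp [Polynomial.derivative_pow, hz, hw]
    ring
  have hy : ∫ p, (p.2 : ℂ) * (z p ^ a * w p ^ b) ∂(γ.prod γ) =
      1 / 2 * ∫ p, (Complex.I * a) * (z p ^ (a - 1) * w p ^ b) +
        (-Complex.I * b) * (z p ^ a * w p ^ (b - 1)) ∂(γ.prod γ) := by
    rw [integral_prod _ hy1, integral_prod
      (fun p => (Complex.I * a) * (z p ^ (a - 1) * w p ^ b) +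
        (-Complex.I * b) * (z p ^ a * w p ^ (b - 1)))
      ((h1.const_mul _).add (h2.const_mul _)),
      ← integral_const_mul]
    congr 1 with x
    have := integral_mul_polynomial_gaussianReal (v := 1 / 2) (by simp)
      ((Polynomial.C (x : ℂ) + Polynomial.X * Polynomial.C Complex.I) ^ a *
        (Polynomial.C (x : ℂ) - Polynomial.X * Polynomial.C Complex.I) ^ b)
    simp only [Polynomial.eval_mul, Polynomial.eval_pow, Polynomial.eval_add, Polynomial.eval_sub,
      Polynomial.eval_X, Polynomial.eval_C, hv] at this
    rw [this]
    congr 2 with y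
    simp [Polynomial.derivative_pow, hz, hw]
    ring
  rw [integral_stdComplexGaussian, integral_stdComplexGaussian]
  simp only [hconj]
  change ∫ p, z p ^ a * w p ^ (b + 1) ∂(γ.prod γ) = a * ∫ p, z p ^ (a - 1) * w p ^ b ∂(γ.prod γ)
  -- With `z̄ = x - iy`, the two real identities combine to `½(∂ₓ - i∂_y)`. This is `∂/∂z`, so the
  -- terms in `b` cancel. The truncated exponents `a - 1` and `b - 1` are harmless, being multiplied
  -- by `a` and `b`.
  have hsplit : ∫ p, z p ^ a * w p ^ (b + 1) ∂(γ.prod γ) =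
      ∫ p, (p.1 : ℂ) * (z p ^ a * w p ^ b) ∂(γ.prod γ) -
        Complex.I * ∫ p, (p.2 : ℂ) * (z p ^ a * w p ^ b) ∂(γ.prod γ) := by
    rw [← integral_const_mul, ← integral_sub hx1 (hy1.const_mul _)]
    congr 1 with p
    simp only [hw]
    ring
  rw [hsplit, hx, hy, integral_add (h1.const_mul _) (h2.const_mul _),
    integral_add (h1.const_mul _) (h2.const_mul _)]
  simp only [integral_const_mul]
  ring_nf
  simp only [Complex.I_sq]
  ring

end GaussianIntegrationByParts

/-! ### Gaussian expectation as a functional on polynomials in the entries and their conjugates -/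

section GaussianFunctional

/-- Polynomials in the entries of an `M × N` matrix (tag `false`) and their conjugates
(tag `true`). -/
abbrev EntryPolynomial (M N : ℕ) : Type := MvPolynomial ((Fin M × Fin N) × Bool) ℂ

/-- Evaluation at `G` of polynomials in the entries of a complex matrix (tag `false`) and their
conjugates (tag `true`). -/
noncomputable def evalEntries {M N : ℕ} (G : Fin M → Fin N → ℂ) :
    EntryPolynomial M N →ₐ[ℂ] ℂ :=
  MvPolynomial.aeval fun e => if e.2 then starRingEnd ℂ (G e.1.1 e.1.2) else G e.1.1 e.1.2

theorem evalEntries_monomial {M N : ℕ} (G : Fin M → Fin N → ℂ)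
    (s : (Fin M × Fin N) × Bool →₀ ℕ) (r : ℂ) :
    evalEntries G (MvPolynomial.monomial s r) = r * ∏ i, ∏ j,
      (G i j ^ s ((i, j), false) * starRingEnd ℂ (G i j) ^ s ((i, j), true)) := by
  rw [evalEntries, MvPolynomial.aeval_monomial, Finsupp.prod_fintype _ _ (by simp),
    Fintype.prod_prod_type, Fintype.prod_prod_type]
  simp [mul_comm]

instance {M N : ℕ} : IsProbabilityMeasure (complexGaussianMatrix M N) := by
  unfold complexGaussianMatrix
  infer_instance

theorem integrable_evalEntries {M N : ℕ} (p : EntryPolynomial M N) :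
    Integrable (fun G => evalEntries G p) (complexGaussianMatrix M N) := by
  induction p using MvPolynomial.induction_on' with
  | monomial s r =>
    simp_rw [evalEntries_monomial]
    refine Integrable.const_mul ?_ _
    exact Integrable.fintype_prod fun i => Integrable.fintype_prod
      (f := fun j (z : ℂ) => z ^ s ((i, j), false) * starRingEnd ℂ z ^ s ((i, j), true))
      fun j => integrable_monomial_stdComplexGaussian _ _
  | add p q hp hq =>
    simp_rw [map_add]
    exact hp.add hq

/-- Expectation of a polynomial in the entries of a complex Gaussian matrix and their
conjugates. -/
noncomputable def gaussianExpectation (M N : ℕ) :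
    EntryPolynomial M N →ₗ[ℂ] ℂ where
  toFun p := ∫ G, evalEntries G p ∂(complexGaussianMatrix M N)
  map_add' p q := by
    simp_rw [map_add]
    exact integral_add (integrable_evalEntries p) (integrable_evalEntries q)
  map_smul' r p := by
    simp_rw [map_smul, smul_eq_mul]
    exact integral_const_mul _ _

theorem gaussianExpectation_apply {M N : ℕ} (p : EntryPolynomial M N) :
    gaussianExpectation M N p = ∫ G, evalEntries G p ∂(complexGaussianMatrix M N) := rfl

theorem gaussianExpectation_one (M N : ℕ) : gaussianExpectation M N 1 = 1 := by
  simp [gaussianExpectation_apply]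

theorem gaussianExpectation_monomial {M N : ℕ} (s : (Fin M × Fin N) × Bool →₀ ℕ) (r : ℂ) :
    gaussianExpectation M N (MvPolynomial.monomial s r) = r * ∏ e,
      ∫ z : ℂ, z ^ s (e, false) * (starRingEnd ℂ z) ^ s (e, true) ∂stdComplexGaussian := by
  rw [gaussianExpectation_apply]
  simp_rw [evalEntries_monomial]
  rw [integral_const_mul, complexGaussianMatrix, Fintype.prod_prod_type]
  congr 1
  refine (integral_fintype_prod_eq_prod
    (f := fun i (g : Fin N → ℂ) => ∏ j, (g j ^ s ((i, j), false) *
      starRingEnd ℂ (g j) ^ s ((i, j), true)))).trans (Finset.prod_congr rfl fun i _ => ?_)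
  exact integral_fintype_prod_eq_prod
    (f := fun j (z : ℂ) => z ^ s ((i, j), false) * starRingEnd ℂ z ^ s ((i, j), true))

/-- Integration by parts for a complex Gaussian matrix. -/
theorem gaussianExpectation_conj_mul {M N : ℕ} (e : Fin M × Fin N)
    (p : EntryPolynomial M N) :
    gaussianExpectation M N (MvPolynomial.X (e, true) * p) =
      gaussianExpectation M N (MvPolynomial.pderiv (e, false) p) := by
  induction p using MvPolynomial.induction_on' with
  | monomial s r =>
    rw [MvPolynomial.X, MvPolynomial.monomial_mul, MvPolynomial.pderiv_monomial,
      gaussianExpectation_monomial, gaussianExpectation_monomial, one_mul, mul_assoc]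
    congr 1
    -- By independence only the factor of the entry `e` is affected by the integration by parts.
    rw [Fintype.prod_eq_mul_prod_compl e, Fintype.prod_eq_mul_prod_compl e, ← mul_assoc]
    congr 1
    · simpa [add_comm] using
        integral_conj_mul_monomial_stdComplexGaussian (s (e, false)) (s (e, true))
    · refine Finset.prod_congr rfl fun d hd => ?_
      have hd' : e ≠ d := by
        rintro rfl
        simp at hd
      simp [hd']
  | add p q hp hq => rw [mul_add, map_add, map_add, map_add, hp, hq]

end GaussianFunctional

/-! ### The loop equation for traces of Wishart matrices -/

section LoopEquation

/-- The generic matrix. -/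
noncomputable def genericEntries (M N : ℕ) :
    Matrix (Fin M) (Fin N) (EntryPolynomial M N) :=
  Matrix.of fun i j => MvPolynomial.X ((i, j), false)

/-- The generic adjoint matrix. -/
noncomputable def genericConj (M N : ℕ) :
    Matrix (Fin N) (Fin M) (EntryPolynomial M N) :=
  Matrix.of fun j i => MvPolynomial.X ((i, j), true)

/-- The generic (unnormalized) Wishart matrix. -/
noncomputable def genericWishart (M N : ℕ) :
    Matrix (Fin N) (Fin N) (EntryPolynomial M N) :=
  genericConj M N * genericEntries M N

/-- The traces of the powers of the generic Wishart matrix. -/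
noncomputable def genericTrace (M N k : ℕ) : EntryPolynomial M N :=
  (genericWishart M N ^ k).trace

/-- The derivation `∑ (Z Wᵏ)ᵢⱼ ∂/∂Zᵢⱼ`. -/
noncomputable def loopDerivation (M N k : ℕ) :
    Derivation ℂ (EntryPolynomial M N) (EntryPolynomial M N) :=
  ∑ e : Fin M × Fin N, (genericEntries M N * genericWishart M N ^ k) e.1 e.2 •
    MvPolynomial.pderiv (e, false)

variable {M N : ℕ}

theorem map_mul_apply_of_derivation {R B : Type*} [CommRing R] [CommRing B] [Algebra R B]
    (D : Derivation R B B) {l m n : Type*} [Fintype m] (U : Matrix l m B) (V : Matrix m n B) :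
    (U * V).map D = U * V.map D + U.map D * V := by
  ext i j
  simp only [Matrix.map_apply, Matrix.mul_apply, Matrix.add_apply, map_sum, Derivation.leibniz,
    smul_eq_mul, Finset.sum_add_distrib]
  congr 1
  exact Finset.sum_congr rfl fun _ _ => mul_comm _ _

theorem pderiv_genericConj (e : Fin M × Fin N) :
    (genericConj M N).map (MvPolynomial.pderiv (e, false)) = 0 := by
  ext1 i j
  simp [genericConj, MvPolynomial.pderiv_X]

theorem pderiv_genericEntries (e : Fin M × Fin N) :
    (genericEntries M N).map (MvPolynomial.pderiv (e, false)) = Matrix.single e.1 e.2 1 := by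
  ext1 i j
  simp only [genericEntries, Matrix.map_apply, Matrix.of_apply, MvPolynomial.pderiv_X,
    Matrix.single_apply, Pi.single_apply]
  congr 1
  simp [Prod.ext_iff, eq_comm]

theorem loopDerivation_apply (k : ℕ) (p : EntryPolynomial M N) :
    loopDerivation M N k p = ∑ e : Fin M × Fin N,
      (genericEntries M N * genericWishart M N ^ k) e.1 e.2 *
        MvPolynomial.pderiv (e, false) p := by
  have h := congrFun (map_sum Derivation.coeFnAddMonoidHom (fun e : Fin M × Fin N =>
    (genericEntries M N * genericWishart M N ^ k) e.1 e.2 •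
      (MvPolynomial.pderiv (e, false) :
        Derivation ℂ (EntryPolynomial M N) (EntryPolynomial M N))) Finset.univ) p
  rw [Finset.sum_apply] at h
  exact h

theorem loopDerivation_genericConj (k : ℕ) :
    (genericConj M N).map (loopDerivation M N k) = 0 := by
  ext1 i j
  simp [loopDerivation_apply, genericConj, MvPolynomial.pderiv_X]

theorem loopDerivation_genericEntries (k : ℕ) :
    (genericEntries M N).map (loopDerivation M N k) =
      genericEntries M N * genericWishart M N ^ k := by
  ext1 i j
  rw [Matrix.map_apply, loopDerivation_apply]
  have h (e : Fin M × Fin N) : MvPolynomial.pderiv (e, false) (genericEntries M N i j) =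
      if (i, j) = e then 1 else 0 := by
    simp [genericEntries, MvPolynomial.pderiv_X, Pi.single_apply]
  simp_rw [h]
  rw [Finset.sum_eq_single (i, j)]
  · simp
  · intro e _ he
    simp [he.symm]
  · simp

theorem loopDerivation_genericWishart (k : ℕ) :
    (genericWishart M N).map (loopDerivation M N k) = genericWishart M N ^ (k + 1) := by
  rw [genericWishart, map_mul_apply_of_derivation, loopDerivation_genericConj,
    loopDerivation_genericEntries, Matrix.zero_mul, add_zero, ← Matrix.mul_assoc, pow_succ']
  rfl

/-- The derivation sends `W` to `Wᵏ⁺¹`, which commutes with `W`, so the Leibniz rule produces `a`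
equal terms. -/
theorem loopDerivation_genericWishart_pow (k a : ℕ) :
    (genericWishart M N ^ a).map (loopDerivation M N k) =
      (a : EntryPolynomial M N) • genericWishart M N ^ (k + a) := by
  induction a with
  | zero =>
    ext1 i j
    simp only [pow_zero, Matrix.map_apply, Matrix.one_apply, Nat.cast_zero, zero_smul,
      Matrix.zero_apply]
    split_ifs <;> simp
  | succ a ih =>
    rw [pow_succ, map_mul_apply_of_derivation, ih, loopDerivation_genericWishart, ← pow_add,
      Matrix.smul_mul, ← pow_succ]
    push_cast
    rw [add_smul, one_smul, add_comm]
    congr 2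
    ring

theorem loopDerivation_genericTrace (k a : ℕ) :
    loopDerivation M N k (genericTrace M N a) = a * genericTrace M N (k + a) := by
  have h := congrArg Matrix.trace (loopDerivation_genericWishart_pow (M := M) (N := N) k a)
  rw [Matrix.trace_smul, smul_eq_mul] at h
  rw [genericTrace, genericTrace, ← h, Matrix.trace, map_sum]
  rfl

theorem pderiv_genericWishart_pow (e : Fin M × Fin N) (k : ℕ) :
    (genericWishart M N ^ k).map (MvPolynomial.pderiv (e, false)) =
      ∑ l ∈ Finset.range k, genericWishart M N ^ l * genericConj M N *
        Matrix.single e.1 e.2 (1 : EntryPolynomial M N) * genericWishart M N ^ (k - 1 - l) := by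
  induction k with
  | zero =>
    ext1 i j
    simp only [pow_zero, Matrix.map_apply, Matrix.one_apply, Finset.range_zero, Finset.sum_empty,
      Matrix.zero_apply]
    split_ifs <;> simp
  | succ k ih =>
    have hW : (genericWishart M N).map (MvPolynomial.pderiv (e, false)) =
        genericConj M N * Matrix.single e.1 e.2 (1 : EntryPolynomial M N) := by
      rw [genericWishart, map_mul_apply_of_derivation, pderiv_genericConj, pderiv_genericEntries,
        Matrix.zero_mul, add_zero]
    rw [pow_succ, map_mul_apply_of_derivation, ih, hW, Finset.sum_range_succ, add_comm,
      Matrix.sum_mul]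
    refine congrArg₂ (· + ·) (Finset.sum_congr rfl fun l hl => ?_) ?_
    · have hl' : k - 1 - l + 1 = k + 1 - 1 - l := by
        have := Finset.mem_range.1 hl
        omega
      rw [Matrix.mul_assoc, ← pow_succ, hl']
    · rw [Nat.add_sub_cancel, Nat.sub_self, pow_zero, Matrix.mul_one, Matrix.mul_assoc]

/-- Contracting over the position of the unit matrix decouples the two sides. This is how
differentiating one trace splits it into two. -/
theorem sum_mul_single_mul_apply {B : Type*} [CommRing B] (U : Matrix (Fin M) (Fin M) B)
    (V : Matrix (Fin N) (Fin N) B) :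
    ∑ e : Fin M × Fin N, (U * Matrix.single e.1 e.2 (1 : B) * V) e.1 e.2 = U.trace * V.trace := by
  rw [Fintype.sum_prod_type, Matrix.trace, Matrix.trace, Finset.sum_mul_sum]
  refine Finset.sum_congr rfl fun i _ => Finset.sum_congr rfl fun j _ => ?_
  rw [Matrix.mul_apply, Finset.sum_eq_single j]
  · simp
  · intro b _ hb
    dsimp only
    rw [Matrix.mul_single_apply_of_ne (hbj := hb), zero_mul]
  · simp

/-- The divergence of the vector field `Z Wᵏ`. -/
theorem sum_pderiv_genericEntries_mul_pow (k : ℕ) :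
    ∑ e : Fin M × Fin N, MvPolynomial.pderiv (e, false)
      ((genericEntries M N * genericWishart M N ^ k) e.1 e.2) =
      M * genericTrace M N k + ∑ l ∈ Finset.range k,
        genericTrace M N (l + 1) * genericTrace M N (k - 1 - l) := by
  have h (e : Fin M × Fin N) : MvPolynomial.pderiv (e, false)
      ((genericEntries M N * genericWishart M N ^ k) e.1 e.2) =
      ((1 : Matrix (Fin M) (Fin M) (EntryPolynomial M N)) *
        Matrix.single e.1 e.2 (1 : EntryPolynomial M N) * genericWishart M N ^ k) e.1 e.2 +
      ∑ l ∈ Finset.range k, ((genericEntries M N * genericWishart M N ^ l * genericConj M N) *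
        Matrix.single e.1 e.2 (1 : EntryPolynomial M N) * genericWishart M N ^ (k - 1 - l)) e.1 e.2 := by
    have := congrFun (congrFun (map_mul_apply_of_derivation (MvPolynomial.pderiv (e, false))
      (genericEntries M N) (genericWishart M N ^ k)) e.1) e.2
    rw [Matrix.map_apply] at this
    rw [this, pderiv_genericWishart_pow, pderiv_genericEntries, Matrix.add_apply, add_comm,
      Matrix.one_mul, Matrix.mul_sum, Matrix.sum_apply]
    simp only [Matrix.mul_assoc]
  simp_rw [h, Finset.sum_add_distrib]
  rw [sum_mul_single_mul_apply, Finset.sum_comm]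
  congr 1
  · simp [genericTrace]
  · refine Finset.sum_congr rfl fun l _ => ?_
    -- Cyclicity turns the trace of the `M × M` matrix `Z Wˡ Z*` into that of `Wˡ⁺¹`.
    rw [sum_mul_single_mul_apply, Matrix.trace_mul_comm, ← Matrix.mul_assoc, ← genericWishart,
      ← pow_succ']
    rfl

/-- The loop equation for complex Wishart matrices. -/
theorem gaussianExpectation_genericTrace_succ_mul (k : ℕ)
    (p : EntryPolynomial M N) :
    gaussianExpectation M N (genericTrace M N (k + 1) * p) =
      M * gaussianExpectation M N (genericTrace M N k * p) +
      ∑ l ∈ Finset.range k, gaussianExpectation M N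
        (genericTrace M N (l + 1) * (genericTrace M N (k - 1 - l) * p)) +
      gaussianExpectation M N (loopDerivation M N k p) := by
  -- Writing `Wᵏ⁺¹ = Z*(Z Wᵏ)` exhibits one conjugate entry in each term, which integration by parts
  -- trades for a derivative.
  have htr : genericTrace M N (k + 1) * p = ∑ e : Fin M × Fin N, MvPolynomial.X (e, true) *
      ((genericEntries M N * genericWishart M N ^ k) e.1 e.2 * p) := by
    have h1 : genericTrace M N (k + 1) = ∑ e : Fin M × Fin N, MvPolynomial.X (e, true) *
      (genericEntries M N * genericWishart M N ^ k) e.1 e.2 := by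
      rw [genericTrace, pow_succ', genericWishart, Matrix.mul_assoc, ← genericWishart,
        Fintype.sum_prod_type, Finset.sum_comm]
      rfl
    rw [h1, Finset.sum_mul]
    exact Finset.sum_congr rfl fun _ _ => mul_assoc _ _ _
  have hM : (M : EntryPolynomial M N) * genericTrace M N k * p =
      (M : ℂ) • (genericTrace M N k * p) := by
    rw [MvPolynomial.smul_eq_C_mul, mul_assoc]
    simp
  -- The divergence of `p · Z Wᵏ` is `p` times the divergence of `Z Wᵏ`, plus the vector field
  -- applied to `p`. The first part splits a trace; on products of traces the second merges two.
  have key : ∑ e : Fin M × Fin N, MvPolynomial.pderiv (e, false)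
      ((genericEntries M N * genericWishart M N ^ k) e.1 e.2 * p) =
      (M : ℂ) • (genericTrace M N k * p) +
      ∑ l ∈ Finset.range k, genericTrace M N (l + 1) * (genericTrace M N (k - 1 - l) * p) +
      loopDerivation M N k p := by
    simp_rw [Derivation.leibniz, Finset.sum_add_distrib, smul_eq_mul]
    rw [← Finset.mul_sum, sum_pderiv_genericEntries_mul_pow, ← hM, add_comm,
      loopDerivation_apply]
    congr 1
    rw [mul_add, Finset.mul_sum]
    congr 1
    · ring
    · exact Finset.sum_congr rfl fun _ _ => by ring
  rw [htr, map_sum]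
  simp_rw [gaussianExpectation_conj_mul]
  rw [← map_sum, key, map_add, map_add, map_smul, map_sum, smul_eq_mul]

end LoopEquation

/-! ### Normalized correlators and their factorization up to `o(1/N)` -/

section Asymptotics

variable {M N : ℕ}

/-- The lists obtained from a list by adding `k` to one of its entries, each with the entry. -/
def shiftEntries (k : ℕ) : List ℕ → List (ℕ × List ℕ)
  | [] => []
  | a :: L => (a, (k + a) :: L) :: (shiftEntries k L).map fun q => (q.1, a :: q.2)

theorem sum_length_of_mem_shiftEntries {k : ℕ} {L : List ℕ} {q : ℕ × List ℕ}
    (hq : q ∈ shiftEntries k L) : q.2.sum = k + L.sum ∧ q.2.length = L.length := by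
  induction L generalizing q with
  | nil => simp [shiftEntries] at hq
  | cons a L ih =>
    simp only [shiftEntries, List.mem_cons, List.mem_map] at hq
    rcases hq with rfl | ⟨r, hr, rfl⟩
    · simp [add_assoc]
    · obtain ⟨h1, h2⟩ := ih hr
      simp [h1, h2]
      ring

/-- Products of traces of powers of the generic Wishart matrix. -/
noncomputable def traceProduct (M N : ℕ) (L : List ℕ) : EntryPolynomial M N :=
  (L.map (genericTrace M N)).prod

theorem traceProduct_cons (a : ℕ) (L : List ℕ) :
    traceProduct M N (a :: L) = genericTrace M N a * traceProduct M N L := by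
  simp [traceProduct]

theorem loopDerivation_traceProduct (k : ℕ) (L : List ℕ) :
    loopDerivation M N k (traceProduct M N L) =
      ((shiftEntries k L).map fun q => (q.1 : ℂ) • traceProduct M N q.2).sum := by
  induction L with
  | nil => simp [traceProduct, shiftEntries]
  | cons a L ih =>
    rw [traceProduct_cons, Derivation.leibniz, ih, loopDerivation_genericTrace, shiftEntries]
    simp only [List.map_cons, List.sum_cons, List.map_map, Function.comp_def, traceProduct_cons,
      smul_eq_mul]
    rw [add_comm, ← List.sum_map_mul_left]
    congr 1
    · rw [MvPolynomial.smul_eq_C_mul]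
      simp only [map_natCast]
      ring
    · congr 2
      ext1 q
      rw [mul_smul_comm]

/-- Mixed moments `E[∏ tr(X_Nᵃ)]` of a complex Wishart matrix. -/
noncomputable def wishartCorrelator (M N : ℕ) (L : List ℕ) : ℂ :=
  ((N : ℂ) ^ (L.sum + L.length))⁻¹ * gaussianExpectation M N (traceProduct M N L)

theorem wishartCorrelator_nil : wishartCorrelator M N [] = 1 := by
  simp [wishartCorrelator, traceProduct, gaussianExpectation_one]

theorem wishartCorrelator_zero_cons (hN : N ≠ 0) (L : List ℕ) :
    wishartCorrelator M N (0 :: L) = wishartCorrelator M N L := by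
  have hN' : (N : ℂ) ≠ 0 := by exact_mod_cast hN
  have h : traceProduct M N (0 :: L) = (N : ℂ) • traceProduct M N L := by
    rw [traceProduct_cons, MvPolynomial.smul_eq_C_mul]
    simp [genericTrace]
  rw [wishartCorrelator, h, map_smul, wishartCorrelator, List.sum_cons, List.length_cons, zero_add,
    ← add_assoc, pow_succ, smul_eq_mul]
  field_simp

/-- The powers of `N` are set by sum plus length of the list. Splitting lowers the sum and raises
the length by one, so it costs nothing; merging lowers both, whence `N⁻²`; the term in `M` lowers
only the sum, whence `M / N`. -/
theorem wishartCorrelator_succ_cons (hN : N ≠ 0) (k : ℕ) (L : List ℕ) :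
    wishartCorrelator M N ((k + 1) :: L) = (M : ℂ) / N * wishartCorrelator M N (k :: L) +
      ∑ l ∈ Finset.range k, wishartCorrelator M N ((l + 1) :: (k - 1 - l) :: L) +
      ((N : ℂ) ^ 2)⁻¹ *
        ((shiftEntries k L).map fun q => (q.1 : ℂ) * wishartCorrelator M N q.2).sum := by
  have hN' : (N : ℂ) ≠ 0 := by exact_mod_cast hN
  have h2 : ((N : ℂ) ^ (k + 1 + L.sum + (L.length + 1)))⁻¹ *
      gaussianExpectation M N (loopDerivation M N k (traceProduct M N L)) = ((N : ℂ) ^ 2)⁻¹ *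
        ((shiftEntries k L).map fun q => (q.1 : ℂ) * wishartCorrelator M N q.2).sum := by
    rw [loopDerivation_traceProduct, map_list_sum, List.map_map, ← List.sum_map_mul_left,
      ← List.sum_map_mul_left]
    congr 1
    refine List.map_congr_left fun q hq => ?_
    obtain ⟨hq1, hq2⟩ := sum_length_of_mem_shiftEntries hq
    simp only [Function.comp_apply, map_smul, smul_eq_mul, wishartCorrelator, hq1, hq2]
    rw [show k + 1 + L.sum + (L.length + 1) = (k + L.sum + L.length) + 2 by ring, pow_add]
    field_simp
  have h1 : ((N : ℂ) ^ (k + 1 + L.sum + (L.length + 1)))⁻¹ * ∑ l ∈ Finset.range k,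
      gaussianExpectation M N (genericTrace M N (l + 1) *
        (genericTrace M N (k - 1 - l) * traceProduct M N L)) =
      ∑ l ∈ Finset.range k, wishartCorrelator M N ((l + 1) :: (k - 1 - l) :: L) := by
    rw [Finset.mul_sum]
    refine Finset.sum_congr rfl fun l hl => ?_
    have hl' := Finset.mem_range.1 hl
    rw [wishartCorrelator, traceProduct_cons, traceProduct_cons]
    congr 3
    simp only [List.sum_cons, List.length_cons]
    omega
  rw [wishartCorrelator, traceProduct_cons, gaussianExpectation_genericTrace_succ_mul,
    List.sum_cons, List.length_cons, mul_add, mul_add, h1, h2, wishartCorrelator, traceProduct_cons,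
    List.sum_cons, List.length_cons]
  congr 2
  rw [show k + 1 + L.sum + (L.length + 1) = (k + L.sum + (L.length + 1)) + 1 by ring, pow_succ]
  field_simp

theorem wishartMoment_eq_wishartCorrelator (k : ℕ) :
    wishartMoment M N k = wishartCorrelator M N [k] := by
  have hmat (G : Fin M → Fin N → ℂ) : (genericWishart M N).map (evalEntries G) =
      (Matrix.of G).conjTranspose * Matrix.of G := by
    ext i j
    simp [genericWishart, Matrix.mul_apply, genericConj, genericEntries, evalEntries]
  have htr (G : Fin M → Fin N → ℂ) : evalEntries G (genericTrace M N k) =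
      (((Matrix.of G).conjTranspose * Matrix.of G) ^ k).trace := by
    have hpow := map_pow (evalEntries G).mapMatrix (genericWishart M N) k
    simp only [AlgHom.mapMatrix_apply] at hpow
    rw [← hmat, ← hpow, genericTrace]
    simp [Matrix.trace]
  rw [wishartMoment, wishartCorrelator, traceProduct, gaussianExpectation_apply,
    ← integral_const_mul]
  congr 1 with G
  simp only [List.map_cons, List.map_nil, List.prod_cons, List.prod_nil, mul_one, htr,
    wishartMatrix, smul_pow, Matrix.trace_smul, smul_eq_mul, List.sum_cons, List.sum_nil,
    List.length_cons, List.length_nil, pow_succ, mul_inv, inv_pow, add_zero, zero_add]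
  ring

/-- Asymptotic factorization of the mixed moments of complex Wishart matrices, to order
`o(1/N)`. -/
theorem tendsto_mul_wishartCorrelator_sub_prod {M N : ℕ → ℕ} (hN : Tendsto N atTop atTop) {c : ℂ}
    (hc : Tendsto (fun n => (M n : ℂ) / N n) atTop (𝓝 c)) {f : ℕ → ℂ}
    (hf : ∀ k, Tendsto (fun n => wishartCorrelator (M n) (N n) [k]) atTop (𝓝 (f k)))
    (L : List ℕ) :
    Tendsto (fun n => (N n : ℂ) * (wishartCorrelator (M n) (N n) L -
      (L.map fun a => wishartCorrelator (M n) (N n) [a]).prod)) atTop (𝓝 0) := by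
  -- The weight `2` on the sum makes splitting decrease the measure: the sum drops by one while the
  -- length grows by one.
  induction h : 2 * L.sum + L.length using Nat.strong_induction_on generalizing L with
  | _ m ih =>
  have hN0 : ∀ᶠ n in atTop, N n ≠ 0 := (hN.eventually_ge_atTop 1).mono fun n hn => by omega
  have hinv : Tendsto (fun n => ((N n : ℂ))⁻¹) atTop (𝓝 0) :=
    (tendsto_inv_atTop_nhds_zero_nat (𝕜 := ℂ)).comp hN
  have hprod (L : List ℕ) : Tendsto
      (fun n => (L.map fun a => wishartCorrelator (M n) (N n) [a]).prod) atTop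
      (𝓝 (L.map f).prod) := tendsto_list_prod L fun a _ => hf a
  match L with
  | [] => simp [wishartCorrelator_nil]
  | 0 :: L =>
    refine (ih (2 * L.sum + L.length) (by simp at h; omega) L rfl).congr' ?_
    filter_upwards [hN0] with n hn
    simp [wishartCorrelator_zero_cons hn, wishartCorrelator_nil]
  | (k + 1) :: L =>
    -- The induction hypothesis makes the merged correlators converge, hence bounded. Multiplied by
    -- `N · N⁻²`, they contribute nothing.
    have hbdd (q : ℕ × List ℕ) (hq : q ∈ shiftEntries k L) : Tendsto
        (fun n => (q.1 : ℂ) * wishartCorrelator (M n) (N n) q.2) atTop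
        (𝓝 (q.1 * (0 * 0 + (q.2.map f).prod))) := by
      obtain ⟨h1, h2⟩ := sum_length_of_mem_shiftEntries hq
      have := ih (2 * q.2.sum + q.2.length)
        (by simp only [List.sum_cons, List.length_cons] at h; omega) q.2 rfl
      refine (((hinv.mul this).add (hprod q.2)).const_mul _).congr' ?_
      filter_upwards [hN0] with n hn
      have : (N n : ℂ) ≠ 0 := by exact_mod_cast hn
      field_simp
      ring
    have t1 := hc.mul (ih (2 * (k :: L).sum + (k :: L).length)
      (by simp only [List.sum_cons, List.length_cons] at h ⊢; omega) (k :: L) rfl)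
    have t2 : Tendsto (fun n => ∑ l ∈ Finset.range k, (N n : ℂ) *
        (wishartCorrelator (M n) (N n) ((l + 1) :: (k - 1 - l) :: L) -
          (((l + 1) :: (k - 1 - l) :: L).map fun a => wishartCorrelator (M n) (N n) [a]).prod))
        atTop (𝓝 (∑ l ∈ Finset.range k, 0)) := by
      refine tendsto_finsetSum _ fun l hl => ih _ ?_ _ rfl
      have := Finset.mem_range.1 hl
      simp only [List.sum_cons, List.length_cons] at h ⊢
      omega
    -- The recursion for the single moment `E[tr Xᵏ⁺¹]` contains the pair correlators and not the
    -- products of moments, so their defect must be subtracted as well.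
    have t3 : Tendsto (fun n => (∑ l ∈ Finset.range k, (N n : ℂ) *
        (wishartCorrelator (M n) (N n) [l + 1, k - 1 - l] -
          ([l + 1, k - 1 - l].map fun a => wishartCorrelator (M n) (N n) [a]).prod)) *
        (L.map fun a => wishartCorrelator (M n) (N n) [a]).prod)
        atTop (𝓝 ((∑ l ∈ Finset.range k, 0) * (L.map f).prod)) := by
      refine (tendsto_finsetSum _ fun l hl => ih _ ?_ _ rfl).mul (hprod L)
      have := Finset.mem_range.1 hl
      simp only [List.sum_cons, List.length_cons, List.sum_nil, List.length_nil] at h ⊢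
      omega
    have t4 := hinv.mul (tendsto_list_sum (shiftEntries k L) hbdd)
    have := ((t1.add t2).sub t3).add t4
    simp only [mul_zero, Finset.sum_const_zero, zero_mul, add_zero, sub_zero] at this
    refine this.congr' ?_
    filter_upwards [hN0] with n hn
    have hn' : (N n : ℂ) ≠ 0 := by exact_mod_cast hn
    rw [wishartCorrelator_succ_cons hn, List.map_cons, List.map_cons, List.prod_cons,
      List.prod_cons, wishartCorrelator_succ_cons hn k []]
    simp only [shiftEntries, List.map_nil, List.sum_nil, List.map_cons, List.prod_cons,
      List.prod_nil, mul_one, mul_zero, add_zero, mul_sub, Finset.sum_sub_distrib, sub_mul,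
      ← Finset.mul_sum, mul_add, add_mul, Finset.sum_mul, mul_assoc]
    field_simp
    ring

end Asymptotics

/-! ### Free Poisson recursion for the limit moments and their infinitesimal parts -/

section WishartLimit

/-- For a single trace the loop equation has no merging term, so the `1/N` correction comes only
from the corrections to the moments and from `M/N`. The second identity is the first one
differentiated, with `c'` the derivative of `c`. -/
theorem InfProbSpace.IsWishartLimit.moment_succ {A : Type*} [Ring A] [Algebra ℂ A]
    {P : InfProbSpace A} {x : A} {c c' : ℝ} (hx : P.IsWishartLimit x c c') (k : ℕ) :
    P.phi (x ^ (k + 1)) = c * P.phi (x ^ k) +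
        ∑ l ∈ Finset.range k, P.phi (x ^ (l + 1)) * P.phi (x ^ (k - 1 - l)) ∧
      P.dphi (x ^ (k + 1)) = c * P.dphi (x ^ k) + c' * P.phi (x ^ k) +
        ∑ l ∈ Finset.range k, (P.phi (x ^ (l + 1)) * P.dphi (x ^ (k - 1 - l)) +
          P.dphi (x ^ (l + 1)) * P.phi (x ^ (k - 1 - l))) := by
  obtain ⟨M, N, hN, hc, hc', hm⟩ := hx
  simp only [wishartMoment_eq_wishartCorrelator] at hm
  have hN0 : ∀ᶠ n in atTop, N n ≠ 0 := (hN.eventually_ge_atTop 1).mono fun n hn => by omega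
  have hinv : Tendsto (fun n => ((N n : ℂ))⁻¹) atTop (𝓝 0) :=
    (tendsto_inv_atTop_nhds_zero_nat (𝕜 := ℂ)).comp hN
  have hcC : Tendsto (fun n => (M n : ℂ) / N n) atTop (𝓝 (c : ℂ)) := by
    have := (Complex.continuous_ofReal.tendsto c).comp hc
    simpa [Function.comp_def] using this
  have hcC' : Tendsto (fun n => (M n : ℂ) - N n * c) atTop (𝓝 (c' : ℂ)) := by
    have := (Complex.continuous_ofReal.tendsto c').comp hc'
    simpa [Function.comp_def] using this
  have hfac := tendsto_mul_wishartCorrelator_sub_prod hN hcC fun k => (hm k).1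
  have hpair (a b : ℕ) : Tendsto (fun n => (N n : ℂ) * (wishartCorrelator (M n) (N n) [a, b] -
      P.phi (x ^ a) * P.phi (x ^ b))) atTop
      (𝓝 (P.phi (x ^ a) * P.dphi (x ^ b) + P.dphi (x ^ a) * P.phi (x ^ b))) := by
    -- Up to the factorization defect, this is the discrete product rule `mₐm_b - φₐφ_b = φₐ(m_b -
    -- φ_b) + (mₐ - φₐ)m_b`.
    have := ((hfac [a, b]).add ((hm b).2.const_mul (P.phi (x ^ a)))).add ((hm a).2.mul (hm b).1)
    rw [zero_add] at this
    refine this.congr fun n => ?_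
    simp only [List.map_cons, List.map_nil, List.prod_cons, List.prod_nil]
    ring
  have hpair' (a b : ℕ) : Tendsto (fun n => wishartCorrelator (M n) (N n) [a, b]) atTop
      (𝓝 (P.phi (x ^ a) * P.phi (x ^ b))) := by
    have := (hinv.mul (hpair a b)).add_const (P.phi (x ^ a) * P.phi (x ^ b))
    rw [zero_mul, zero_add] at this
    refine this.congr' ?_
    filter_upwards [hN0] with n hn
    have : (N n : ℂ) ≠ 0 := by exact_mod_cast hn
    field_simp
    ring
  have hrec : ∀ᶠ n in atTop, wishartCorrelator (M n) (N n) [k + 1] =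
      (M n : ℂ) / N n * wishartCorrelator (M n) (N n) [k] +
      ∑ l ∈ Finset.range k, wishartCorrelator (M n) (N n) [l + 1, k - 1 - l] := by
    filter_upwards [hN0] with n hn
    rw [wishartCorrelator_succ_cons hn]
    simp [shiftEntries]
  have h1 : P.phi (x ^ (k + 1)) = c * P.phi (x ^ k) +
      ∑ l ∈ Finset.range k, P.phi (x ^ (l + 1)) * P.phi (x ^ (k - 1 - l)) := by
    refine tendsto_nhds_unique ((hm (k + 1)).1.congr' hrec) ?_
    exact (hcC.mul (hm k).1).add (tendsto_finsetSum _ fun l _ => hpair' _ _)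
  refine ⟨h1, tendsto_nhds_unique (hm (k + 1)).2 ?_⟩
  -- Here `N((M/N)mₖ - cφₖ)` is split as `c·N(mₖ - φₖ) + (M - Nc)mₖ`, which is where `c'` enters.
  have h2 := (((hm k).2.const_mul (c : ℂ)).add (hcC'.mul (hm k).1)).add
    (tendsto_finsetSum (Finset.range k) fun l _ => hpair (l + 1) (k - 1 - l))
  refine h2.congr' ?_
  filter_upwards [hN0, hrec] with n hn hn'
  have : (N n : ℂ) ≠ 0 := by exact_mod_cast hn
  rw [hn', h1, ← Finset.mul_sum, Finset.sum_sub_distrib]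
  field_simp
  ring

end WishartLimit

/-! ### Alternating words, free derivations, and extension of the moment identity by freeness -/

section FreeWords

open scoped TensorProduct

variable {R F ι : Type*} [CommRing R] [Ring F] [Algebra R F]

/-- `CentredWord τ S i j p`: the element `p` is an alternating product of `τ`-centred elements of
the algebras `S`, the first factor lying in `S i` and the last one in `S j`. -/
inductive CentredWord (τ : F →ₗ[R] R) (S : ι → Subalgebra R F) : ι → ι → F → Prop
  | single {i : ι} {a : F} (ha : a ∈ S i) (h0 : τ a = 0) : CentredWord τ S i i a
  | cons {i j k : ι} {a p : F} (ha : a ∈ S i) (h0 : τ a = 0) (hij : i ≠ j)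
      (hp : CentredWord τ S j k p) : CentredWord τ S i k (a * p)

/-- The functional `τ ⊗ τ`. -/
noncomputable def tensorSquare (τ : F →ₗ[R] R) : F ⊗[R] F →ₗ[R] R :=
  LinearMap.mul' R R ∘ₗ TensorProduct.map τ τ

@[simp]
theorem tensorSquare_tmul (τ : F →ₗ[R] R) (a b : F) : tensorSquare τ (a ⊗ₜ b) = τ a * τ b := by
  simp [tensorSquare]

/-- The span of the elementary tensors of elements of a subalgebra. -/
def tensorSpan (S : Subalgebra R F) : Submodule R (F ⊗[R] F) :=
  Submodule.span R {t | ∃ a ∈ S, ∃ b ∈ S, t = a ⊗ₜ b}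

/-- A linear map `F → F ⊗ F` that is a derivation for the outer bimodule structure. -/
def IsFreeDerivation (d : F →ₗ[R] F ⊗[R] F) : Prop :=
  ∀ p q, d (p * q) = (p ⊗ₜ 1) * d q + d p * (1 ⊗ₜ q)

variable {τ : F →ₗ[R] R} {S : ι → Subalgebra R F}

theorem CentredWord.mul {i j k l : ι} {p q : F} (hp : CentredWord τ S i j p) (hjk : j ≠ k)
    (hq : CentredWord τ S k l q) : CentredWord τ S i l (p * q) := by
  induction hp with
  | single ha h0 => exact .cons ha h0 hjk hq
  | cons ha h0 hij _ ih => rw [mul_assoc]; exact .cons ha h0 hij (ih hjk)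

theorem map_sub_smul_one (h1 : τ 1 = 1) (a : F) : τ (a - τ a • 1) = 0 := by
  simp [h1]

theorem sub_smul_one_mem {T : Subalgebra R F} {a : F} (ha : a ∈ T) (r : R) : a - r • 1 ∈ T :=
  sub_mem ha (T.smul_mem (one_mem _) r)

/-- The last factor need not be centred: its scalar part leaves the shorter word `p`, on which `τ`
already vanishes. -/
theorem CentredWord.map_mul_eq_zero (h1 : τ 1 = 1)
    (hfree : ∀ {i j p}, CentredWord τ S i j p → τ p = 0) {i j k : ι} {p a : F}
    (hp : CentredWord τ S i j p) (hjk : j ≠ k) (ha : a ∈ S k) : τ (p * a) = 0 := by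
  have h := hfree (hp.mul hjk (.single (sub_smul_one_mem ha (τ a)) (map_sub_smul_one h1 a)))
  rwa [mul_sub, mul_smul_comm, mul_one, map_sub, map_smul, hfree hp, smul_zero, sub_zero] at h

theorem CentredWord.map_mul_eq_zero' (h1 : τ 1 = 1)
    (hfree : ∀ {i j p}, CentredWord τ S i j p → τ p = 0) {i j k : ι} {p a : F}
    (hp : CentredWord τ S j k p) (hij : i ≠ j) (ha : a ∈ S i) : τ (a * p) = 0 := by
  have h := hfree (.cons (sub_smul_one_mem ha (τ a)) (map_sub_smul_one h1 a) hij hp)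
  rwa [sub_mul, smul_mul_assoc, one_mul, map_sub, map_smul, hfree hp, smul_zero, sub_zero] at h

theorem tensorSquare_eq_zero_of_mem_tensorSpan {T : Subalgebra R F} (f : F ⊗[R] F →ₗ[R] R)
    (hf : ∀ a ∈ T, ∀ b ∈ T, f (a ⊗ₜ b) = 0) {t : F ⊗[R] F} (ht : t ∈ tensorSpan T) : f t = 0 := by
  have : tensorSpan T ≤ LinearMap.ker f := by
    refine Submodule.span_le.2 ?_
    rintro _ ⟨a, ha, b, hb, rfl⟩
    exact hf a ha b hb
  exact this ht

/-- Differentiating any letter of `p` leaves as left leg a nonempty centred word times one element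
of the next algebra, and `τ` vanishes on it. The nonempty prefix `q` is needed: without it,
differentiating the first letter could leave a scalar on the left. -/
theorem CentredWord.tensorSquare_mul_eq_zero (h1 : τ 1 = 1)
    (hfree : ∀ {i j p}, CentredWord τ S i j p → τ p = 0) {d : F →ₗ[R] F ⊗[R] F}
    (hd : IsFreeDerivation d) (hdS : ∀ i, ∀ a ∈ S i, d a ∈ tensorSpan (S i)) {i j k l : ι} {p q : F}
    (hq : CentredWord τ S i j q) (hjk : j ≠ k) (hp : CentredWord τ S k l p) :
    tensorSquare τ ((q ⊗ₜ 1) * d p) = 0 := by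
  induction hp generalizing i j q with
  | single ha h0 =>
    refine tensorSquare_eq_zero_of_mem_tensorSpan
      (tensorSquare τ ∘ₗ LinearMap.mulLeft R (q ⊗ₜ 1)) (fun b hb b' _ => ?_) (hdS _ _ ha)
    simp [hq.map_mul_eq_zero h1 hfree hjk hb]
  | @cons k k' l a p ha h0 hkk' hp ih =>
    rw [hd, mul_add, map_add, ← mul_assoc, Algebra.TensorProduct.tmul_mul_tmul, mul_one,
      ih (hq.mul hjk (.single ha h0)) hkk', zero_add, ← mul_assoc]
    refine tensorSquare_eq_zero_of_mem_tensorSpan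
      (tensorSquare τ ∘ₗ LinearMap.mulRight R (1 ⊗ₜ p) ∘ₗ LinearMap.mulLeft R (q ⊗ₜ 1))
      (fun b hb b' _ => ?_) (hdS _ _ ha)
    simp [hq.map_mul_eq_zero h1 hfree hjk hb]

theorem span_one_centredWord (h1 : τ 1 = 1) (hS : ⨆ i, S i = ⊤) :
    Submodule.span R ({1} ∪ {p | ∃ i j, CentredWord τ S i j p}) = ⊤ := by
  set V := Submodule.span R ({1} ∪ {p | ∃ i j, CentredWord τ S i j p}) with hV
  have hone : (1 : F) ∈ V := Submodule.subset_span (Or.inl rfl)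
  have hword {i j : ι} {p : F} (hp : CentredWord τ S i j p) : p ∈ V :=
    Submodule.subset_span (Or.inr ⟨i, j, hp⟩)
  have hcons {i j k : ι} {a p : F} (ha : a ∈ S i) (hij : i ≠ j) (hp : CentredWord τ S j k p) :
      a * p ∈ V := by
    have h := add_mem (hword (.cons (sub_smul_one_mem ha (τ a)) (map_sub_smul_one h1 a) hij hp))
      (V.smul_mem (τ a) (hword hp))
    rwa [sub_mul, smul_mul_assoc, one_mul, sub_add_cancel] at h
  have hmem {i : ι} {a : F} (ha : a ∈ S i) : a ∈ V := by
    have h := add_mem (hword (.single (sub_smul_one_mem ha (τ a)) (map_sub_smul_one h1 a)))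
      (V.smul_mem (τ a) hone)
    rwa [sub_add_cancel] at h
  -- The elements whose left multiplication preserves the span form a subalgebra; it suffices that
  -- it contains each `S i`. A letter from the same algebra as the first one is absorbed into it and
  -- recentred.
  let T : Subalgebra R F :=
    { carrier := {p | ∀ v ∈ V, p * v ∈ V}
      mul_mem' := fun {p q} hp hq v hv => by rw [mul_assoc]; exact hp _ (hq v hv)
      add_mem' := fun {p q} hp hq v hv => by rw [add_mul]; exact add_mem (hp v hv) (hq v hv)
      algebraMap_mem' := fun r v hv => by
        rw [← Algebra.smul_def]
        exact V.smul_mem r hv }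
  have hT : T = ⊤ := by
    refine top_le_iff.1 (hS ▸ iSup_le fun i a ha v hv => ?_)
    refine Submodule.span_induction ?_ (by simp) (fun v w _ _ hv hw => ?_)
      (fun r v _ hv => ?_) hv
    · rintro v (rfl | ⟨j, k, hv⟩)
      · rw [mul_one]
        exact hmem ha
      · by_cases hij : i = j
        · subst hij
          cases hv with
          | single hb h0 => exact hmem (mul_mem ha hb)
          | cons hb h0 hij hp =>
            rw [← mul_assoc]
            exact hcons (mul_mem ha hb) hij hp
        · exact hcons ha hij hv
    · rw [mul_add]
      exact add_mem hv hw
    · rw [mul_smul_comm]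
      exact V.smul_mem r hv
  refine top_le_iff.1 fun p _ => ?_
  have hp : p ∈ T := by rw [hT]; trivial
  simpa using hp 1 hone

/-- If `τ(x a) = c τ(a) + (τ ⊗ τ)(d a)` holds for `a` in the algebra `S i` of `x`, and the free
derivation `d` vanishes on the other algebras, then it holds for all `a`. -/
theorem map_mul_eq_add_tensorSquare (h1 : τ 1 = 1)
    (hfree : ∀ {i j p}, CentredWord τ S i j p → τ p = 0) (hS : ⨆ i, S i = ⊤)
    {d : F →ₗ[R] F ⊗[R] F} (hd : IsFreeDerivation d)
    (hdS : ∀ i, ∀ a ∈ S i, d a ∈ tensorSpan (S i)) {i : ι}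
    (hdi : ∀ j, j ≠ i → ∀ a ∈ S j, d a = 0) {x : F} (hx : x ∈ S i) {c : R}
    (hL : ∀ a ∈ S i, τ (x * a) = c * τ a + tensorSquare τ (d a)) (p : F) :
    τ (x * p) = c * τ p + tensorSquare τ (d p) := by
  let L : F →ₗ[R] R := τ ∘ₗ LinearMap.mulLeft R x - (c • τ + tensorSquare τ ∘ₗ d)
  have hLapp (p : F) : L p = τ (x * p) - (c * τ p + tensorSquare τ (d p)) := rfl
  suffices h : L = 0 by
    have := LinearMap.congr_fun h p
    rw [hLapp] at this
    exact sub_eq_zero.1 this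
  suffices h : Submodule.span R ({1} ∪ {p | ∃ i j, CentredWord τ S i j p}) ≤ LinearMap.ker L by
    rw [span_one_centredWord h1 hS, top_le_iff] at h
    exact LinearMap.ker_eq_top.1 h
  refine Submodule.span_le.2 ?_
  rintro p (rfl | ⟨j, k, hp⟩)
  · simp only [SetLike.mem_coe, LinearMap.mem_ker, hLapp]
    rw [hL 1 (one_mem _), sub_self]
  · simp only [SetLike.mem_coe, LinearMap.mem_ker, hLapp]
    rw [hfree hp, mul_zero, zero_add]
    by_cases hij : i = j
    · subst hij
      cases hp with
      | single ha h0 => rw [hL _ ha, h0, mul_zero, zero_add, sub_self]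
      -- Here `xa` stays in `S i`, so `τ(xap) = 0`. Of `d(ap)`, the part differentiating `p` has
      -- vanishing left leg; the part differentiating `a` has right leg `b'p` with `b' ∈ S i`, again
      -- killed by `τ`.
      | @cons _ j _ a p ha h0 hij hp =>
        rw [← mul_assoc, hp.map_mul_eq_zero' h1 hfree hij (mul_mem hx ha), zero_sub, neg_eq_zero,
          hd, map_add, CentredWord.tensorSquare_mul_eq_zero h1 hfree hd hdS (.single ha h0) hij hp,
          zero_add]
        refine tensorSquare_eq_zero_of_mem_tensorSpan
          (tensorSquare τ ∘ₗ LinearMap.mulRight R (1 ⊗ₜ p)) (fun b hb b' hb' => ?_) (hdS _ _ ha)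
        simp [hp.map_mul_eq_zero' h1 hfree hij hb']
    · rw [hp.map_mul_eq_zero' h1 hfree hij hx, zero_sub, neg_eq_zero]
      cases hp with
      | single ha h0 => rw [hdi _ (Ne.symm hij) _ ha, map_zero]
      | cons ha h0 hjk hp =>
        rw [hd, hdi _ (Ne.symm hij) _ ha, zero_mul, add_zero]
        exact CentredWord.tensorSquare_mul_eq_zero h1 hfree hd hdS (.single ha h0) hjk hp

theorem IsFreeDerivation.map_one {d : F →ₗ[R] F ⊗[R] F} (hd : IsFreeDerivation d) : d 1 = 0 := by
  have h := hd 1 1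
  rw [mul_one, ← Algebra.TensorProduct.one_def, one_mul, mul_one] at h
  exact left_eq_add.1 h

theorem IsFreeDerivation.map_algebraMap {d : F →ₗ[R] F ⊗[R] F} (hd : IsFreeDerivation d) (r : R) :
    d (algebraMap R F r) = 0 := by
  rw [Algebra.algebraMap_eq_smul_one, map_smul, hd.map_one, smul_zero]

theorem IsFreeDerivation.mem_tensorSpan_adjoin {d : F →ₗ[R] F ⊗[R] F} (hd : IsFreeDerivation d)
    {u : F} (hu : d u ∈ tensorSpan (Algebra.adjoin R {u})) {a : F}
    (ha : a ∈ Algebra.adjoin R {u}) : d a ∈ tensorSpan (Algebra.adjoin R {u}) := by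
  have hl {p : F} (hp : p ∈ Algebra.adjoin R {u}) : tensorSpan (Algebra.adjoin R {u}) ≤
      (tensorSpan (Algebra.adjoin R {u})).comap (LinearMap.mulLeft R (p ⊗ₜ 1)) := by
    refine Submodule.span_le.2 ?_
    rintro _ ⟨b, hb, b', hb', rfl⟩
    exact Submodule.subset_span ⟨p * b, mul_mem hp hb, b', hb', by simp⟩
  have hr {p : F} (hp : p ∈ Algebra.adjoin R {u}) : tensorSpan (Algebra.adjoin R {u}) ≤
      (tensorSpan (Algebra.adjoin R {u})).comap (LinearMap.mulRight R (1 ⊗ₜ p)) := by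
    refine Submodule.span_le.2 ?_
    rintro _ ⟨b, hb, b', hb', rfl⟩
    exact Submodule.subset_span ⟨b, hb, b' * p, mul_mem hb' hp, by simp⟩
  induction ha using Algebra.adjoin_induction with
  | mem a ha =>
    rw [Set.mem_singleton_iff] at ha
    exact ha ▸ hu
  | algebraMap r => rw [hd.map_algebraMap]; exact zero_mem _
  | add p q _ _ hp hq => rw [map_add]; exact add_mem hp hq
  | mul p q hp' hq' hp hq => rw [hd]; exact add_mem (hl hp' hq) (hr hq' hp)

theorem IsFreeDerivation.eq_zero_of_mem_adjoin {d : F →ₗ[R] F ⊗[R] F} (hd : IsFreeDerivation d)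
    {u : F} (hu : d u = 0) {a : F} (ha : a ∈ Algebra.adjoin R {u}) : d a = 0 := by
  induction ha using Algebra.adjoin_induction with
  | mem a ha =>
    rw [Set.mem_singleton_iff] at ha
    exact ha ▸ hu
  | algebraMap r => exact hd.map_algebraMap r
  | add p q _ _ hp hq => rw [map_add, hp, hq, add_zero]
  | mul p q _ _ hp hq => rw [hd, hp, hq, mul_zero, zero_mul, add_zero]

theorem IsFreeDerivation.map_pow_of_right {d : F →ₗ[R] F ⊗[R] F} (hd : IsFreeDerivation d) {w : F}
    (hw : d w = 1 ⊗ₜ w) (k : ℕ) :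
    d (w ^ k) = ∑ l ∈ Finset.range k, (w ^ l) ⊗ₜ[R] (w ^ (k - l)) := by
  induction k with
  | zero => simp [hd.map_one]
  | succ k ih =>
    rw [pow_succ, hd, hw, ih, Finset.sum_range_succ, add_comm, Finset.sum_mul]
    congr 1
    · refine Finset.sum_congr rfl fun l hl => ?_
      have := Finset.mem_range.1 hl
      rw [Algebra.TensorProduct.tmul_mul_tmul, mul_one, ← pow_succ,
        show k - l + 1 = k + 1 - l by omega]
    · simp

theorem IsFreeDerivation.map_pow_of_left {d : F →ₗ[R] F ⊗[R] F} (hd : IsFreeDerivation d) {w : F}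
    (hw : d w = w ⊗ₜ 1) (k : ℕ) :
    d (w ^ k) = ∑ l ∈ Finset.range k, (w ^ (l + 1)) ⊗ₜ[R] (w ^ (k - 1 - l)) := by
  induction k with
  | zero => simp [hd.map_one]
  | succ k ih =>
    rw [pow_succ, hd, hw, ih, Finset.sum_range_succ, add_comm, Finset.sum_mul]
    congr 1
    · refine Finset.sum_congr rfl fun l hl => ?_
      have := Finset.mem_range.1 hl
      rw [Algebra.TensorProduct.tmul_mul_tmul, mul_one, ← pow_succ,
        show k - 1 - l + 1 = k + 1 - 1 - l by omega]
    · simp [pow_succ]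

/-- Free derivations of a free algebra with prescribed values on the generators. -/
theorem FreeAlgebra.exists_isFreeDerivation {X : Type*}
    (f : X → FreeAlgebra R X ⊗[R] FreeAlgebra R X) :
    ∃ d : FreeAlgebra R X →ₗ[R] FreeAlgebra R X ⊗[R] FreeAlgebra R X,
      IsFreeDerivation d ∧ ∀ i, d (FreeAlgebra.ι R i) = f i := by
  -- The upper triangular matrix with diagonal `p ⊗ 1`, `1 ⊗ p` and corner `d p` is multiplicative
  -- in `p` exactly when `d` satisfies the Leibniz rule, so the universal property supplies `d`.
  let ρ : FreeAlgebra R X →ₐ[R] Matrix (Fin 2) (Fin 2) (FreeAlgebra R X ⊗[R] FreeAlgebra R X) :=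
    FreeAlgebra.lift R fun i => !![FreeAlgebra.ι R i ⊗ₜ 1, f i; 0, 1 ⊗ₜ FreeAlgebra.ι R i]
  have hρ (p : FreeAlgebra R X) : ρ p 0 0 = p ⊗ₜ 1 ∧ ρ p 1 0 = 0 ∧ ρ p 1 1 = 1 ⊗ₜ p := by
    induction p using FreeAlgebra.induction with
    | grade0 r =>
      refine ⟨?_, ?_, ?_⟩
      · simp [Matrix.algebraMap_matrix_apply, Algebra.TensorProduct.algebraMap_apply]
      · simp [Matrix.algebraMap_matrix_apply]
      · simp [Algebra.algebraMap_eq_smul_one, Algebra.TensorProduct.one_def]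
    | grade1 i => simp [ρ]
    | mul p q hp hq =>
      simp [Matrix.mul_apply, Fin.sum_univ_two, hp, hq]
    | add p q hp hq =>
      simp [hp, hq, TensorProduct.add_tmul, TensorProduct.tmul_add]
  refine ⟨{ toFun := fun p => ρ p 0 1, map_add' := by simp, map_smul' := by simp }, ?_, ?_⟩
  · intro p q
    simp [Matrix.mul_apply, Fin.sum_univ_two, hρ]
  · intro i
    simp [ρ]

end FreeWords

/-! ### Coupled moment recursions for the product of two free elements -/

section FreePair

open scoped TensorProduct

variable {R : Type*} [CommRing R]

/-- If `τ(u a) = c τ(a) + (τ ⊗ τ)(d a)` holds on the powers of `u`, it holds on the algebra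
generated by `u`. -/
theorem map_mul_eq_add_tensorSquare_of_pow {F : Type*} [Ring F] [Algebra R F] {τ : F →ₗ[R] R}
    {d : F →ₗ[R] F ⊗[R] F} {u : F} {c : R}
    (hu : ∀ k : ℕ, τ (u * u ^ k) = c * τ (u ^ k) + tensorSquare τ (d (u ^ k)))
    {a : F} (ha : a ∈ Algebra.adjoin R {u}) :
    τ (u * a) = c * τ a + tensorSquare τ (d a) := by
  rw [Algebra.adjoin_singleton_eq_range_aeval] at ha
  obtain ⟨p, rfl⟩ := ha
  induction p using Polynomial.induction_on' with
  | add p q hp hq =>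
    simp only [map_add, mul_add] at hp hq ⊢
    rw [hp, hq]
    ring
  | monomial n r =>
    have h : (Polynomial.aeval u) (Polynomial.monomial n r) = r • u ^ n := by
      rw [Polynomial.aeval_monomial, Algebra.smul_def]
    change τ (u * Polynomial.aeval u (Polynomial.monomial n r)) =
      c * τ (Polynomial.aeval u (Polynomial.monomial n r)) +
        tensorSquare τ (d (Polynomial.aeval u (Polynomial.monomial n r)))
    simp only [h, mul_smul_comm, map_smul, hu, smul_eq_mul]
    ring

/-- The moments of a product of two free elements whose moments satisfy the free Poisson
recursion with parameter `c`. -/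
theorem moments_mul_of_freePoisson {τ : FreeAlgebra R (Fin 2) →ₗ[R] R} (h1 : τ 1 = 1)
    (hfree : ∀ {i j p}, CentredWord τ
      (fun i : Fin 2 => Algebra.adjoin R {FreeAlgebra.ι R i}) i j p → τ p = 0) {c : R}
    (hrec : ∀ (i : Fin 2) (k : ℕ), τ (FreeAlgebra.ι R i ^ (k + 1)) =
      c * τ (FreeAlgebra.ι R i ^ k) + ∑ l ∈ Finset.range k,
        τ (FreeAlgebra.ι R i ^ (l + 1)) * τ (FreeAlgebra.ι R i ^ (k - 1 - l)))
    {x y : FreeAlgebra R (Fin 2)} (hx : x = FreeAlgebra.ι R 0) (hy : y = FreeAlgebra.ι R 1)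
    (k : ℕ) :
    τ ((x * y) ^ (k + 1)) = c * τ (y * (x * y) ^ k) +
        ∑ l ∈ Finset.range k, τ (y * (x * y) ^ l) * τ ((x * y) ^ (k - l)) ∧
      τ (y * (x * y) ^ k) = c * τ ((x * y) ^ k) +
        ∑ l ∈ Finset.range k, τ ((x * y) ^ (l + 1)) * τ ((x * y) ^ (k - 1 - l)) := by
  have hS : ⨆ i : Fin 2, Algebra.adjoin R {(FreeAlgebra.ι R i : FreeAlgebra R (Fin 2))} = ⊤ := by
    rw [← Algebra.adjoin_iUnion, Set.iUnion_singleton_eq_range, FreeAlgebra.adjoin_range_ι]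
  have hmem (i : Fin 2) : (FreeAlgebra.ι R i : FreeAlgebra R (Fin 2)) ∈
      Algebra.adjoin R {(FreeAlgebra.ι R i : FreeAlgebra R (Fin 2))} :=
    Algebra.self_mem_adjoin_singleton R _
  constructor
  -- The choice `x ↦ 1 ⊗ x`, `y ↦ 0` gives `d(xy) = 1 ⊗ xy`, so only the words `(xy)ʲ` and `y(xy)ʲ`
  -- appear. The value `x ⊗ 1` would give `d(xy) = x ⊗ y` and further words.
  · obtain ⟨d, hd, hdu⟩ := FreeAlgebra.exists_isFreeDerivation (R := R) (X := Fin 2)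
      ![1 ⊗ₜ x, 0]
    have hdx : d x = 1 ⊗ₜ x := by rw [hx, hdu, hx]; rfl
    have hdy : d y = 0 := by rw [hy, hdu]; rfl
    have hdS (i : Fin 2) : ∀ a ∈ Algebra.adjoin R {(FreeAlgebra.ι R i : FreeAlgebra R (Fin 2))},
        d a ∈ tensorSpan (Algebra.adjoin R {FreeAlgebra.ι R i}) := by
      intro a ha
      refine hd.mem_tensorSpan_adjoin ?_ ha
      fin_cases i
      · exact Submodule.subset_span ⟨1, one_mem _, x, hx ▸ hmem 0, (congrArg d hx.symm).trans hdx⟩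
      · exact ((congrArg d hy.symm).trans hdy) ▸ zero_mem _
    have key := map_mul_eq_add_tensorSquare h1 hfree hS hd hdS (i := 0) (x := x) (c := c)
      (fun j hj a ha => by
        obtain rfl : j = 1 := by omega
        exact hd.eq_zero_of_mem_adjoin (hy ▸ hdy) ha) (hx ▸ hmem 0)
      (fun a ha => by
        refine map_mul_eq_add_tensorSquare_of_pow (fun k => ?_) (hx ▸ ha)
        rw [hd.map_pow_of_right hdx, ← pow_succ', hx, hrec, map_sum]
        congr 1
        -- This placement of `x` in the right leg gives the recursion with the two factors of each
        -- product exchanged.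
        rw [← Finset.sum_range_reflect]
        refine Finset.sum_congr rfl fun l hl => ?_
        have := Finset.mem_range.1 hl
        rw [tensorSquare_tmul, mul_comm, show k - 1 - (k - 1 - l) = l by omega,
          show k - 1 - l + 1 = k - l by omega])
    have hdw : d (x * y) = 1 ⊗ₜ (x * y) := by simp [hd _ _, hdx, hdy]
    rw [pow_succ', mul_assoc, key, hd, hdy, zero_mul, add_zero, hd.map_pow_of_right hdw,
      Finset.mul_sum, map_sum]
    simp
  -- For `y` the mirror choice `y ↦ y ⊗ 1` gives `d(xy) = xy ⊗ 1`, which closes the system.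
  · obtain ⟨d, hd, hdu⟩ := FreeAlgebra.exists_isFreeDerivation (R := R) (X := Fin 2)
      ![0, y ⊗ₜ 1]
    have hdx : d x = 0 := by rw [hx, hdu]; rfl
    have hdy : d y = y ⊗ₜ 1 := by rw [hy, hdu, hy]; rfl
    have hdS (i : Fin 2) : ∀ a ∈ Algebra.adjoin R {(FreeAlgebra.ι R i : FreeAlgebra R (Fin 2))},
        d a ∈ tensorSpan (Algebra.adjoin R {FreeAlgebra.ι R i}) := by
      intro a ha
      refine hd.mem_tensorSpan_adjoin ?_ ha
      fin_cases i
      · exact ((congrArg d hx.symm).trans hdx) ▸ zero_mem _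
      · exact Submodule.subset_span ⟨y, hy ▸ hmem 1, 1, one_mem _, (congrArg d hy.symm).trans hdy⟩
    have key := map_mul_eq_add_tensorSquare h1 hfree hS hd hdS (i := 1) (x := y) (c := c)
      (fun j hj a ha => by
        obtain rfl : j = 0 := by omega
        exact hd.eq_zero_of_mem_adjoin (hx ▸ hdx) ha) (hy ▸ hmem 1)
      (fun a ha => by
        refine map_mul_eq_add_tensorSquare_of_pow (fun k => ?_) (hy ▸ ha)
        rw [hd.map_pow_of_left hdy, ← pow_succ', hy, hrec, map_sum]
        simp)
    have hdw : d (x * y) = (x * y) ⊗ₜ 1 := by simp [hd _ _, hdx, hdy]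
    rw [key, hd.map_pow_of_left hdw, map_sum]
    simp

end FreePair

/-! ### Infinitesimal freeness as freeness over the dual numbers -/

section DualNumbers

open scoped TensorProduct

/-- Makes tensor products with the dual numbers find their ring structure. -/
local instance (priority := 2000) moduleDualNumber : Module ℂ (DualNumber ℂ) := Algebra.toModule

theorem List.prod_ofFn_update_one {A : Type*} [Monoid A] {n : ℕ} (b : Fin (n + 1) → A)
    (j : Fin (n + 1)) : (List.ofFn (Function.update b j 1)).prod =
      (List.ofFn fun k : Fin n => b (j.succAbove k)).prod := by
  induction n with
  | zero =>
    obtain rfl : j = 0 := by omega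
    simp
  | succ n ih =>
    rw [List.ofFn_succ, List.prod_cons]
    cases j using Fin.cases with
    | zero => simp
    | succ j =>
      have h1 : (fun i : Fin (n + 1) => Function.update b j.succ 1 i.succ) =
          Function.update (fun i : Fin (n + 1) => b i.succ) j 1 := by
        ext1 i
        simp [Function.update_apply]
      rw [h1, ih, Function.update_of_ne (Fin.succ_ne_zero j).symm, List.ofFn_succ (n := n),
        List.prod_cons]
      simp

/-- Products of elements `b + ε d`. -/
theorem prod_ofFn_add_eps {A : Type*} [Ring A] [Algebra ℂ A] {n : ℕ} (b d : Fin n → A) :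
    (List.ofFn fun k => (1 : DualNumber ℂ) ⊗ₜ[ℂ] b k + DualNumber.eps ⊗ₜ[ℂ] d k).prod =
      (1 : DualNumber ℂ) ⊗ₜ[ℂ] (List.ofFn b).prod +
        DualNumber.eps ⊗ₜ[ℂ] ∑ j, (List.ofFn (Function.update b j (d j))).prod := by
  induction n with
  | zero => simp [Algebra.TensorProduct.one_def]
  | succ n ih =>
    have h0 : (List.ofFn (Function.update b 0 (d 0))).prod =
        d 0 * (List.ofFn fun k : Fin n => b k.succ).prod := by simp
    have hs (j : Fin n) : (List.ofFn (Function.update b j.succ (d j.succ))).prod =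
        b 0 * (List.ofFn (Function.update (fun k : Fin n => b k.succ) j (d j.succ))).prod := by
      rw [List.ofFn_succ, List.prod_cons, Function.update_of_ne (Fin.succ_ne_zero j).symm]
      congr 3
      ext1 i
      simp [Function.update_apply]
    rw [List.ofFn_succ, List.prod_cons, ih, Fin.sum_univ_succ, h0]
    simp_rw [hs]
    rw [← Finset.mul_sum, List.ofFn_succ (f := b), List.prod_cons]
    simp only [add_mul, mul_add, Algebra.TensorProduct.tmul_mul_tmul, one_mul, mul_one,
      DualNumber.eps_mul_eps, TensorProduct.zero_tmul, TensorProduct.tmul_add, add_zero]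
    abel

theorem CentredWord.exists_ofFn {R F ι : Type*} [CommRing R] [Ring F] [Algebra R F]
    {τ : F →ₗ[R] R} {S : ι → Subalgebra R F} {i j : ι} {p : F} (hp : CentredWord τ S i j p) :
    ∃ (n : ℕ) (e : Fin (n + 1) → ι) (a : Fin (n + 1) → F), e 0 = i ∧
      (∀ k : Fin n, e k.castSucc ≠ e k.succ) ∧ (∀ k, a k ∈ S (e k)) ∧ (∀ k, τ (a k) = 0) ∧
      p = (List.ofFn a).prod := by
  induction hp with
  | @single i a ha h0 => exact ⟨0, fun _ => i, fun _ => a, rfl, by simp, by simpa, by simpa, by simp⟩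
  | @cons i j k a p ha h0 hij hp ih =>
    obtain ⟨n, e, b, he, halt, hb, hb0, rfl⟩ := ih
    refine ⟨n + 1, Fin.cons i e, Fin.cons a b, rfl, ?_, ?_, ?_, ?_⟩
    · intro l
      cases l using Fin.cases with
      | zero => simpa [he] using hij
      | succ l =>
        rw [← Fin.succ_castSucc, Fin.cons_succ, Fin.cons_succ]
        exact halt l
    · intro l
      cases l using Fin.cases with
      | zero => simpa
      | succ l => simpa using hb l
    · intro l
      cases l using Fin.cases with
      | zero => simpa
      | succ l => simpa using hb0 l
    · simp [List.ofFn_succ]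

namespace InfProbSpace

variable {A : Type*} [Ring A] [Algebra ℂ A] (P : InfProbSpace A)

/-- The functional `φ + ε φ'` with values in the dual numbers. -/
noncomputable def dualPhi : A →ₗ[ℂ] DualNumber ℂ where
  toFun a := TrivSqZeroExt.inl (P.phi a) + TrivSqZeroExt.inr (P.dphi a)
  map_add' a b := by ext <;> simp
  map_smul' r a := by ext <;> simp

@[simp] theorem fst_dualPhi (a : A) : TrivSqZeroExt.fst (P.dualPhi a) = P.phi a := by
  simp [dualPhi]

@[simp] theorem snd_dualPhi (a : A) : TrivSqZeroExt.snd (P.dualPhi a) = P.dphi a := by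
  simp [dualPhi]

/-- The extension of `φ + ε φ'` to `A[ε]`. -/
noncomputable def dualExtension : DualNumber ℂ ⊗[ℂ] A →ₗ[DualNumber ℂ] DualNumber ℂ :=
  P.dualPhi.liftBaseChange (DualNumber ℂ)

@[simp] theorem dualExtension_tmul (r : DualNumber ℂ) (a : A) :
    P.dualExtension (r ⊗ₜ a) = r * P.dualPhi a := by
  simp [dualExtension]

/-- The joint distribution of `x`, `y` over the dual numbers, on the free algebra. -/
noncomputable def dualLaw (x y : A) : FreeAlgebra (DualNumber ℂ) (Fin 2) →ₗ[DualNumber ℂ]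
    DualNumber ℂ :=
  P.dualExtension ∘ₗ (FreeAlgebra.lift (DualNumber ℂ)
    fun i => (1 : DualNumber ℂ) ⊗ₜ[ℂ] (![x, y] i)).toLinearMap

theorem dualLaw_apply (x y : A) (p : FreeAlgebra (DualNumber ℂ) (Fin 2)) :
    P.dualLaw x y p = P.dualExtension (FreeAlgebra.lift (DualNumber ℂ)
      (fun i => (1 : DualNumber ℂ) ⊗ₜ[ℂ] (![x, y] i)) p) := rfl

variable {P}

/-- Products of `b + ε d` vanish under `φ + ε φ'` if the factors do and alternate. -/
theorem InfFree.dualExtension_prod_eq_zero {ι : Type*} {S : ι → Subalgebra ℂ A}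
    (h : P.InfFree S) {n : ℕ} {e : Fin (n + 1) → ι} (he : ∀ k : Fin n, e k.castSucc ≠ e k.succ)
    {b d : Fin (n + 1) → A} (hb : ∀ k, b k ∈ S (e k)) (hd : ∀ k, d k ∈ S (e k))
    (h0 : ∀ k, P.dualExtension ((1 : DualNumber ℂ) ⊗ₜ[ℂ] b k + DualNumber.eps ⊗ₜ[ℂ] d k) = 0) :
    P.dualExtension
      (List.ofFn fun k => (1 : DualNumber ℂ) ⊗ₜ[ℂ] b k + DualNumber.eps ⊗ₜ[ℂ] d k).prod = 0 := by
  have hb0 (k) : P.phi (b k) = 0 := by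
    simpa using congrArg TrivSqZeroExt.fst (h0 k)
  have hd0 (k) : P.dphi (b k) = -P.phi (d k) := by
    have := congrArg TrivSqZeroExt.snd (h0 k)
    simp only [map_add, dualExtension_tmul, one_mul, TrivSqZeroExt.snd_add, snd_dualPhi,
      DualNumber.snd_mul, DualNumber.fst_eps, zero_mul, DualNumber.snd_eps, fst_dualPhi, zero_add,
      TrivSqZeroExt.snd_zero] at this
    exact eq_neg_of_add_eq_zero_left this
  obtain ⟨h1, h2⟩ := h n e b he hb hb0
  -- After splitting `d j` into its centred and scalar parts, the centred part gives an alternating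
  -- centred word, killed by `φ`; the scalar part deletes the `j`-th factor.
  have hupd (j : Fin (n + 1)) : P.phi (List.ofFn (Function.update b j (d j))).prod =
      P.phi (d j) * P.phi (List.ofFn fun k : Fin n => b (j.succAbove k)).prod := by
    have hcen : P.phi (List.ofFn (Function.update b j (d j - P.phi (d j) • 1))).prod = 0 := by
      refine (h n e _ he (fun k => ?_) (fun k => ?_)).1
      · by_cases hk : k = j
        · subst hk
          simpa using sub_mem (hd k) ((S (e k)).smul_mem (one_mem _) (P.phi (d k)))
        · simpa [hk] using hb k
      · by_cases hk : k = j
        · subst hk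
          simp [P.phi_one]
        · simpa [hk] using hb0 k
    have hm := (MultilinearMap.mkPiAlgebraFin ℂ (n + 1) A).map_update_add b j
      (d j - P.phi (d j) • 1) (P.phi (d j) • 1)
    rw [MultilinearMap.map_update_smul, sub_add_cancel] at hm
    simp only [MultilinearMap.mkPiAlgebraFin_apply] at hm
    rw [hm, map_add, map_smul, hcen, zero_add, List.prod_ofFn_update_one, smul_eq_mul]
  rw [prod_ofFn_add_eps, map_add, dualExtension_tmul, dualExtension_tmul]
  ext
  · simpa using h1
  · simp only [one_mul, TrivSqZeroExt.snd_add, snd_dualPhi, DualNumber.snd_mul, DualNumber.fst_eps,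
      zero_mul, DualNumber.snd_eps, fst_dualPhi, zero_add, TrivSqZeroExt.snd_zero, h2]
    -- The `ε`-component is `∑ⱼ (φ'(bⱼ) + φ(dⱼ))` times the word without its `j`-th factor, and each
    -- bracket is the `ε`-component of a centred factor, hence zero.
    rw [map_sum, ← Finset.sum_add_distrib]
    simp only [hupd, hd0]
    exact Finset.sum_eq_zero fun j _ => by ring

theorem exists_add_eps_of_mem_adjoin (x y : A) (i : Fin 2)
    {p : FreeAlgebra (DualNumber ℂ) (Fin 2)}
    (hp : p ∈ Algebra.adjoin (DualNumber ℂ)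
      {(FreeAlgebra.ι (DualNumber ℂ) i : FreeAlgebra (DualNumber ℂ) (Fin 2))}) :
    ∃ b ∈ Algebra.adjoin ℂ {![x, y] i}, ∃ d ∈ Algebra.adjoin ℂ {![x, y] i},
      FreeAlgebra.lift (DualNumber ℂ) (fun i => (1 : DualNumber ℂ) ⊗ₜ[ℂ] (![x, y] i)) p =
        (1 : DualNumber ℂ) ⊗ₜ[ℂ] b + DualNumber.eps ⊗ₜ[ℂ] d := by
  induction hp using Algebra.adjoin_induction with
  | mem p hp =>
    rw [Set.mem_singleton_iff] at hp
    exact ⟨_, Algebra.self_mem_adjoin_singleton ℂ _, 0, zero_mem _, by simp [hp]⟩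
  | algebraMap r =>
    refine ⟨algebraMap ℂ A r.fst, Subalgebra.algebraMap_mem _ _, algebraMap ℂ A r.snd,
      Subalgebra.algebraMap_mem _ _, ?_⟩
    rw [AlgHom.commutes, Algebra.TensorProduct.algebraMap_apply,
      Algebra.algebraMap_eq_smul_one (A := A) (TrivSqZeroExt.fst r),
      Algebra.algebraMap_eq_smul_one (A := A) (TrivSqZeroExt.snd r), ← TensorProduct.smul_tmul, ← TensorProduct.smul_tmul,
      ← TensorProduct.add_tmul]
    congr 1
    ext <;> simp
  | add p q _ _ hp hq =>
    obtain ⟨b, hb, d, hd, h⟩ := hp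
    obtain ⟨b', hb', d', hd', h'⟩ := hq
    refine ⟨b + b', add_mem hb hb', d + d', add_mem hd hd', ?_⟩
    rw [map_add, h, h', TensorProduct.tmul_add, TensorProduct.tmul_add]
    abel
  | mul p q _ _ hp hq =>
    obtain ⟨b, hb, d, hd, h⟩ := hp
    obtain ⟨b', hb', d', hd', h'⟩ := hq
    refine ⟨b * b', mul_mem hb hb', b * d' + d * b',
      add_mem (mul_mem hb hd') (mul_mem hd hb'), ?_⟩
    rw [map_mul, h, h']
    simp only [add_mul, mul_add, Algebra.TensorProduct.tmul_mul_tmul, one_mul, mul_one,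
      DualNumber.eps_mul_eps, TensorProduct.zero_tmul, TensorProduct.tmul_add, add_zero]
    abel

/-- The defining formula for `φ'` of an alternating word is exactly what makes the `ε`-component
vanish, once each letter is written as `b + εd` with `b`, `d` in the corresponding algebra over `ℂ`.
-/
theorem InfFreePair.dualLaw_eq_zero {x y : A} (h : P.InfFreePair x y) {i j : Fin 2}
    {p : FreeAlgebra (DualNumber ℂ) (Fin 2)}
    (hp : CentredWord (P.dualLaw x y)
      (fun i : Fin 2 => Algebra.adjoin (DualNumber ℂ) {FreeAlgebra.ι (DualNumber ℂ) i}) i j p) :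
    P.dualLaw x y p = 0 := by
  obtain ⟨n, e, a, -, halt, ha, ha0, rfl⟩ := hp.exists_ofFn
  choose b hb d hd hbd using fun k => exists_add_eps_of_mem_adjoin x y (e k) (ha k)
  rw [dualLaw_apply, map_list_prod, List.map_ofFn]
  simp only [Function.comp_def, hbd]
  refine InfFree.dualExtension_prod_eq_zero h halt hb hd fun k => ?_
  rw [← hbd, ← dualLaw_apply, ha0]

/-- The moments of the product of two infinitesimally free Wishart limits; the `φ(y(xy)ᵏ)` and
`φ'(y(xy)ᵏ)` enter as auxiliary quantities. -/
theorem moments_mul_of_isWishartLimit {x y : A} {c c' : ℝ} (hx : P.IsWishartLimit x c c')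
    (hy : P.IsInfFreeCopy x y) (k : ℕ) :
    P.dualPhi ((x * y) ^ (k + 1)) =
        (TrivSqZeroExt.inl (c : ℂ) + TrivSqZeroExt.inr (c' : ℂ)) * P.dualPhi (y * (x * y) ^ k) +
        ∑ l ∈ Finset.range k, P.dualPhi (y * (x * y) ^ l) * P.dualPhi ((x * y) ^ (k - l)) ∧
      P.dualPhi (y * (x * y) ^ k) =
        (TrivSqZeroExt.inl (c : ℂ) + TrivSqZeroExt.inr (c' : ℂ)) * P.dualPhi ((x * y) ^ k) +
        ∑ l ∈ Finset.range k,
          P.dualPhi ((x * y) ^ (l + 1)) * P.dualPhi ((x * y) ^ (k - 1 - l)) := by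
  have hlaw (p : FreeAlgebra (DualNumber ℂ) (Fin 2)) (a : A)
      (h : FreeAlgebra.lift (DualNumber ℂ) (fun i => (1 : DualNumber ℂ) ⊗ₜ[ℂ] (![x, y] i)) p =
        (1 : DualNumber ℂ) ⊗ₜ[ℂ] a) : P.dualLaw x y p = P.dualPhi a := by
    rw [dualLaw_apply, h, dualExtension_tmul, one_mul]
  have hx1 : P.dualPhi 1 = 1 := by
    ext <;> simp [P.phi_one, P.dphi_one]
  have hrec (k : ℕ) : P.dualPhi (x ^ (k + 1)) =
      (TrivSqZeroExt.inl (c : ℂ) + TrivSqZeroExt.inr (c' : ℂ)) * P.dualPhi (x ^ k) +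
        ∑ l ∈ Finset.range k, P.dualPhi (x ^ (l + 1)) * P.dualPhi (x ^ (k - 1 - l)) := by
    obtain ⟨h1, h2⟩ := hx.moment_succ k
    generalize (c : ℂ) = c at h1 h2 ⊢
    generalize (c' : ℂ) = c' at h2 ⊢
    ext
    · simp [h1, TrivSqZeroExt.fst_sum]
    · simp [h2, TrivSqZeroExt.snd_sum, mul_comm]
  have hpow (i : Fin 2) (k : ℕ) :
      P.dualLaw x y (FreeAlgebra.ι (DualNumber ℂ) i ^ k) = P.dualPhi (x ^ k) := by
    rw [hlaw _ (![x, y] i ^ k) (by simp [Algebra.TensorProduct.tmul_pow])]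
    fin_cases i
    · rfl
    · ext
      · simp [(hy.1 k).1]
      · simp [(hy.1 k).2]
  have h := moments_mul_of_freePoisson (τ := P.dualLaw x y)
    (c := TrivSqZeroExt.inl (c : ℂ) + TrivSqZeroExt.inr (c' : ℂ))
    ((hlaw 1 1 (by simp [Algebra.TensorProduct.one_def])).trans hx1)
    (fun hp => hy.2.dualLaw_eq_zero hp) (fun i k => by simpa only [hpow] using hrec k) rfl rfl k
  have hw (k : ℕ) : P.dualLaw x y ((FreeAlgebra.ι (DualNumber ℂ) 0 *
      FreeAlgebra.ι (DualNumber ℂ) 1) ^ k) = P.dualPhi ((x * y) ^ k) :=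
    hlaw _ _ (by simp [Algebra.TensorProduct.tmul_pow])
  have hyw (k : ℕ) : P.dualLaw x y (FreeAlgebra.ι (DualNumber ℂ) 1 *
      (FreeAlgebra.ι (DualNumber ℂ) 0 * FreeAlgebra.ι (DualNumber ℂ) 1) ^ k) =
      P.dualPhi (y * (x * y) ^ k) :=
    hlaw _ _ (by simp [Algebra.TensorProduct.tmul_pow])
  simpa only [hw, hyw] using h

end InfProbSpace

end DualNumbers

/-! ### Functional equations of the moment series and computation of the `T`-transforms -/

section Series

/-- The moment series of a product of two free elements with free Poisson moments. -/
theorem series_eq_of_moments {R : Type*} [CommRing R] {m n : ℕ → R} {c : R} (h0 : m 0 = 1)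
    (hm : ∀ k, m (k + 1) = c * n k + ∑ l ∈ Finset.range k, n l * m (k - l))
    (hn : ∀ k, n k = c * m k + ∑ l ∈ Finset.range k, m (l + 1) * m (k - 1 - l))
    {F : R⟦X⟧} (hF : F = PowerSeries.mk fun k => if k = 0 then 0 else m k) :
    F = X * ((1 + F) * ((C c + F) * (C c + F))) := by
  have hF0 : coeff 0 F = 0 := by rw [hF, coeff_mk, if_pos rfl]
  have hFs (k : ℕ) : coeff (k + 1) F = m (k + 1) := by
    rw [hF, coeff_mk, if_neg (Nat.succ_ne_zero k)]
  have hM : (1 + F : R⟦X⟧) = PowerSeries.mk m := by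
    ext k
    cases k with
    | zero => rw [map_add, hF0, coeff_mk, h0, coeff_zero_one, add_zero]
    | succ k => simp [hFs, coeff_one]
  -- The convolution in `hn` has first index at least one, so it is a coefficient of `F(1 + F)`;
  -- likewise the second index `k - l ≥ 1` in `hm` gives the series of `n` times `F`.
  have hN : PowerSeries.mk n = (C c + F) * (1 + F) := by
    ext k
    rw [hM, add_mul, map_add, coeff_C_mul, coeff_mk, coeff_mk, hn, coeff_mul,
      Finset.Nat.sum_antidiagonal_eq_sum_range_succ (fun i j => coeff i F * coeff j (mk m)) k,
      Finset.sum_range_succ', hF0, zero_mul, add_zero]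
    congr 1
    refine Finset.sum_congr rfl fun l _ => ?_
    rw [hFs, coeff_mk, Nat.sub_sub, Nat.add_comm 1 l]
  have hFN : F = X * (C c * PowerSeries.mk n + PowerSeries.mk n * F) := by
    ext k
    cases k with
    | zero => rw [hF0, coeff_zero_X_mul]
    | succ k =>
      rw [hFs, coeff_succ_X_mul, map_add, coeff_C_mul, coeff_mk, hm, coeff_mul,
        Finset.Nat.sum_antidiagonal_eq_sum_range_succ (fun i j => coeff i (mk n) * coeff j F) k,
        Finset.sum_range_succ, Nat.sub_self, hF0, mul_zero, add_zero]
      congr 1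
      refine Finset.sum_congr rfl fun l hl => ?_
      have := Finset.mem_range.1 hl
      rw [coeff_mk, show k - l = (k - l - 1) + 1 by omega, hFs]
  rw [hN] at hFN
  refine hFN.trans ?_
  ring

/-- The coefficientwise projection of a power series over the dual numbers. -/
noncomputable def fstSeries : (DualNumber ℂ)⟦X⟧ →+* ℂ⟦X⟧ :=
  PowerSeries.map (TrivSqZeroExt.fstHom ℂ ℂ ℂ).toRingHom

theorem coeff_fstSeries (F : (DualNumber ℂ)⟦X⟧) (k : ℕ) :
    coeff k (fstSeries F) = TrivSqZeroExt.fst (coeff k F) := rfl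

theorem fstSeries_C (r : DualNumber ℂ) : fstSeries (C r) = C (TrivSqZeroExt.fst r) :=
  map_C _ _

theorem fstSeries_X : fstSeries X = X := map_X _

/-- The infinitesimal part of a power series over the dual numbers. -/
noncomputable def sndSeries (F : (DualNumber ℂ)⟦X⟧) : ℂ⟦X⟧ :=
  PowerSeries.mk fun k => TrivSqZeroExt.snd (coeff k F)

theorem sndSeries_add (F G : (DualNumber ℂ)⟦X⟧) :
    sndSeries (F + G) = sndSeries F + sndSeries G := by
  ext k
  simp [sndSeries]

theorem sndSeries_mul (F G : (DualNumber ℂ)⟦X⟧) :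
    sndSeries (F * G) = fstSeries F * sndSeries G + sndSeries F * fstSeries G := by
  ext k
  simp [sndSeries, coeff_mul, coeff_fstSeries, TrivSqZeroExt.snd_sum, Finset.sum_add_distrib]

theorem sndSeries_C (r : DualNumber ℂ) : sndSeries (C r) = C (TrivSqZeroExt.snd r) := by
  ext k
  simp only [sndSeries, coeff_mk, coeff_C]
  split_ifs <;> simp

theorem sndSeries_one : sndSeries 1 = 0 := by
  rw [← map_one (C (R := DualNumber ℂ)), sndSeries_C, TrivSqZeroExt.snd_one, map_zero]

theorem sndSeries_X : sndSeries X = 0 := by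
  ext k
  simp only [sndSeries, coeff_mk, coeff_X]
  split_ifs <;> simp

namespace InfProbSpace

variable {A : Type*} [Ring A] [Algebra ℂ A] {P : InfProbSpace A} {x y : A} {c c' : ℝ}

theorem dualPhi_one : P.dualPhi 1 = 1 := by
  ext <;> simp [P.phi_one, P.dphi_one]

/-- The case `k = 0` of the coupled recursions reads `Φ(xy) = γΦ(y) = γ²`. -/
theorem phi_mul_of_isWishartLimit (hx : P.IsWishartLimit x c c') (hy : P.IsInfFreeCopy x y) :
    P.phi (x * y) = (c : ℂ) ^ 2 := by
  obtain ⟨h1, h2⟩ := moments_mul_of_isWishartLimit hx hy 0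
  have h3 := congrArg TrivSqZeroExt.fst h1
  rw [h2] at h3
  generalize (c : ℂ) = c at h3 ⊢
  generalize (c' : ℂ) = c' at h3
  simpa [dualPhi_one, P.phi_one, sq] using h3

/-- The functional equations of the moment series of the product. -/
theorem psi_dpsi_mul_eq (hx : P.IsWishartLimit x c c') (hy : P.IsInfFreeCopy x y) :
    P.psi (x * y) = X * ((1 + P.psi (x * y)) * (C (c : ℂ) + P.psi (x * y)) ^ 2) ∧
      P.dpsi (x * y) = X * (P.dpsi (x * y) * (C (c : ℂ) + P.psi (x * y)) ^ 2 +
        2 * (1 + P.psi (x * y)) * (C (c : ℂ) + P.psi (x * y)) *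
          (C (c' : ℂ) + P.dpsi (x * y))) := by
  set F : (DualNumber ℂ)⟦X⟧ :=
    PowerSeries.mk fun k => if k = 0 then 0 else P.dualPhi ((x * y) ^ k) with hF
  have h := series_eq_of_moments (m := fun k => P.dualPhi ((x * y) ^ k))
    (n := fun k => P.dualPhi (y * (x * y) ^ k)) (by simp [dualPhi_one])
    (fun k => (moments_mul_of_isWishartLimit hx hy k).1)
    (fun k => (moments_mul_of_isWishartLimit hx hy k).2) hF
  have hfst : fstSeries F = P.psi (x * y) := by
    ext k
    simp only [hF, psi, coeff_fstSeries, coeff_mk]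
    split_ifs <;> simp
  have hsnd : sndSeries F = P.dpsi (x * y) := by
    ext k
    simp only [hF, dpsi, sndSeries, coeff_mk]
    split_ifs <;> simp
  generalize (c : ℂ) = c at h ⊢
  generalize (c' : ℂ) = c' at h ⊢
  have hC : TrivSqZeroExt.fst (TrivSqZeroExt.inl c + TrivSqZeroExt.inr c' : DualNumber ℂ) = c := by
    rw [TrivSqZeroExt.fst_add, TrivSqZeroExt.fst_inl, TrivSqZeroExt.fst_inr, add_zero]
  have hC' : TrivSqZeroExt.snd (TrivSqZeroExt.inl c + TrivSqZeroExt.inr c' : DualNumber ℂ) = c' := by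
    rw [TrivSqZeroExt.snd_add, TrivSqZeroExt.snd_inl, TrivSqZeroExt.snd_inr, zero_add]
  generalize (TrivSqZeroExt.inl c + TrivSqZeroExt.inr c' : DualNumber ℂ) = r at h hC hC'
  constructor
  · have h1 := congrArg fstSeries h
    simp only [map_mul, map_add, map_one, fstSeries_C, fstSeries_X, hfst, hC] at h1
    refine h1.trans ?_
    ring
  · have h1 := congrArg sndSeries h
    simp only [sndSeries_mul, sndSeries_add, sndSeries_C, sndSeries_one, sndSeries_X, map_mul,
      map_add, map_one, fstSeries_C, fstSeries_X, hfst, hC, hC', hsnd] at h1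
    refine h1.trans ?_
    ring

end InfProbSpace

/-- Formal computation of the `T`-transforms from the functional equations of the moment series. -/
theorem InfProbSpace.transforms_of_psi_dpsi_eq {A : Type*} [Ring A] [Algebra ℂ A]
    {P : InfProbSpace A} {a : A} {c c' : ℂ} (ha : P.phi a ≠ 0)
    (hψ : P.psi a = X * ((1 + P.psi a) * (C c + P.psi a) ^ 2))
    (hdψ : P.dpsi a = X * (P.dpsi a * (C c + P.psi a) ^ 2 +
      2 * (1 + P.psi a) * (C c + P.psi a) * (C c' + P.dpsi a))) :
    P.TTransform a ha = (C c + X) ^ 2 ∧ P.dTTransform a ha = 2 * C c' * (C c + X) := by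
  obtain ⟨hχ0, hdχ0, hS0⟩ := P.transforms_wellDefined a ha
  have hχψ := (P.psi_subst_psiInv a ha).1
  have hdef : P.dpsiInv a ha =
    -(derivative ℂ (P.psiInv a ha) * (P.dpsi a).subst (P.psiInv a ha)) := rfl
  have hSdef : P.STransform a ha = (1 + X) * divZ (P.psiInv a ha) := rfl
  have hdSdef : P.dSTransform a ha = (1 + X) * divZ (P.dpsiInv a ha) := rfl
  have hT : P.TTransform a ha = (P.STransform a ha)⁻¹ := rfl
  have hdT : P.dTTransform a ha = -(P.TTransform a ha * P.dSTransform a ha * P.TTransform a ha) :=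
    rfl
  have hZ := X_mul_divZ _ hχ0
  have hdZ := X_mul_divZ _ hdχ0
  set χ := P.psiInv a ha
  have hsub : HasSubst χ := HasSubst.of_constantCoeff_zero' hχ0
  set g := (P.dpsi a).subst χ
  have hsC (r : ℂ) : (C r).subst χ = (C r : ℂ⟦X⟧) := subst_C r
  -- Substituting `χ` for the variable turns `ψ` into `z` and makes the equation explicit in `χ`.
  have h1 : (X : ℂ⟦X⟧) = χ * ((1 + X) * (C c + X) ^ 2) := by
    have := congrArg (substAlgHom hsub) hψ
    simp only [map_mul, map_add, map_pow, map_one, substAlgHom_X] at this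
    simpa only [coe_substAlgHom, hχψ, hsC] using this
  have h2 : g = χ * (g * (C c + X) ^ 2 + 2 * (1 + X) * (C c + X) * (C c' + g)) := by
    have := congrArg (substAlgHom hsub) hdψ
    simp only [map_mul, map_add, map_pow, map_one, map_ofNat, substAlgHom_X] at this
    simpa only [coe_substAlgHom, hχψ, hsC] using this
  have h3 : (1 : ℂ⟦X⟧) = derivative ℂ χ * ((1 + X) * (C c + X) ^ 2) +
      χ * ((C c + X) ^ 2 + 2 * (1 + X) * (C c + X)) := by
    have := congrArg (derivative ℂ) h1
    simp only [Derivation.leibniz, Derivation.leibniz_pow, map_add, derivative_X, derivative_C,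
      Derivation.map_one_eq_zero, smul_eq_mul, nsmul_eq_mul] at this
    refine this.trans ?_
    push_cast
    ring
  have hX1 : (1 + X : ℂ⟦X⟧) ≠ 0 := fun h => by
    simpa [coeff_one] using congrArg (coeff 1) h
  have hXc : (C c + X : ℂ⟦X⟧) ≠ 0 := fun h => by
    simpa [coeff_C] using congrArg (coeff 1) h
  -- By `h3`, the total coefficient of `g` in `h2` is `χ'(1 + z)(c + z)²`; cancelling `(1 + z)(c +
  -- z)` leaves the product `χ'g` that defines the infinitesimal inverse.
  have h4 : derivative ℂ χ * g * (C c + X) = 2 * C c' * χ := by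
    refine mul_right_cancel₀ (mul_ne_zero hX1 hXc) ?_
    linear_combination h2 - g * h3
  have hS : P.STransform a ha * (C c + X) ^ 2 = 1 := by
    refine mul_left_cancel₀ (X_ne_zero (R := ℂ)) ?_
    rw [hSdef]
    linear_combination (1 + X) * (C c + X) ^ 2 * hZ - h1
  -- Thus `∂S = -2c'(c + z)⁻³`. The equation is kept in multiplied form and cancelled against `T² =
  -- (c + z)⁴` at the end.
  have hdS : P.dSTransform a ha * (C c + X) ^ 3 = -(2 * C c') := by
    refine mul_left_cancel₀ (X_ne_zero (R := ℂ)) ?_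
    rw [hdSdef]
    rw [hdef] at hdZ ⊢
    linear_combination (1 + X) * (C c + X) ^ 3 * hdZ - (1 + X) * (C c + X) ^ 2 * h4 +
      2 * C c' * h1
  have hTT : P.TTransform a ha = (C c + X) ^ 2 := by
    rw [hT, eq_comm, eq_inv_iff_mul_eq_one hS0, mul_comm]
    exact hS
  refine ⟨hTT, ?_⟩
  rw [hdT, hTT]
  linear_combination -(C c + X) * hdS

end Series

theorem mainTheorem9 {A : Type*} [Ring A] [Algebra ℂ A] (P : InfProbSpace A) (x y : A)
    (c c' : ℝ) (hc : c ≠ 0) (hx : P.IsWishartLimit x c c') (hy : P.IsInfFreeCopy x y) :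
    ∃ h : P.phi (x * y) ≠ 0,
      P.TTransform (x * y) h =
        C ((c : ℂ) ^ 2) + C (2 * (c : ℂ)) * (X : ℂ⟦X⟧) + (X : ℂ⟦X⟧) ^ 2 ∧
      P.dTTransform (x * y) h = C (2 * (c' : ℂ)) * (C (c : ℂ) + (X : ℂ⟦X⟧)) := by
  have h : P.phi (x * y) ≠ 0 := by
    rw [InfProbSpace.phi_mul_of_isWishartLimit hx hy]
    exact pow_ne_zero 2 (by exact_mod_cast hc)
  obtain ⟨hψ, hdψ⟩ := InfProbSpace.psi_dpsi_mul_eq hx hy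
  obtain ⟨hT, hdT⟩ := InfProbSpace.transforms_of_psi_dpsi_eq h hψ hdψ
  refine ⟨h, hT.trans ?_, hdT.trans ?_⟩
  · simp only [map_pow, map_mul, map_ofNat]
    ring
  · simp only [map_mul, map_ofNat]
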